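/- **Definitions.** A *centred Catalan set* of size $n+1$ ($n\ge 0$) is a set $S\subseteq\{-n,\dots,n\}$ with $|S|=n+1$ and $|S\cap\{-i,\dots,i\}|\ge i+1$ for all $0\le i\le n$; in particular $0\in S$. Write $S=\{s_1<\dots<s_u<0<s_{u+1}<\dots<s_n\}$. For $l\ge 1$, an *$(n,l)$-AS-trapezoid* is an array of $n$ centred rows, the $i$-th row from the bottom having $l+2i-1$ entries, with entries in $\{-1,0,1\}$, such that all row-sums are $1$, the central $l-1$ columns have column-sum $0$, the non-zero entries alternate in sign along every row and every column, and in every column the first non-zero entry from the top is positive. Its columns are labelled $-n+1,\dots,l+n-1$ from left to right. The set associated with such an array consists of $0$ together with the numbers $j-1$ for the labels $j\le 0$, and $j-(l-1)$ for the labels $j>0$, of columns with positive column-sum. Let $w_l(S)$ be the number of $(n,l)$-AS-trapezoids whose associated set is $S$ (for $n=0$ only the empty array occurs, and $w_l(\{0\})=1$). The *Motzkin path* $\mathbf M(S)$ is the path from $(0,0)$ to $(n,0)$ whose $i$-th step is $(1,m_i)$ with $m_i=|\{-i,i\}\cap S|-1$, and $\mathrm{area}(\mathbf M(S))$ is the area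 between it and the $x$-axis. Let $\lambda(S)=(u+1-s_{u+1},\dots,n-s_n)'$, where $'$ denotes the conjugate Young diagram, and $\mu(S)=(-s_1-u,\dots,-s_u-1)$. Let $f^{\lambda/\mu}$ be the number of standard Young tableaux of skew shape $\lambda/\mu$, and $|\lambda/\mu|$ its number of cells. **Theorem.** Let $S$ be a centred Catalan set. Then $\mu(S)\subseteq\lambda(S)$ and $|\lambda(S)/\mu(S)|=\mathrm{area}(\mathbf M(S))$, and there is a polynomial $P\in\mathbb Q[l]$ with $P(l)=w_l(S)$ for all integers $l\ge 1$; it has degree $|\lambda(S)/\mu(S)|=\mathrm{area}(\mathbf M(S))$ and leading coefficient $$\frac{f^{\lambda(S)/\mu(S)}}{|\lambda(S)/\mu(S)|!}.$$ -/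

import Mathlib

namespace CentredCatalan

/-- `S` is a centred Catalan set of size `n`: an `n`-element subset of `{-n+1, …, n-1}` that
meets `{-i, …, i}` in at least `i + 1` elements for all `0 ≤ i ≤ n - 1`. -/
def IsCentredCatalanSet (n : ℕ) (S : Finset ℤ) : Prop :=
  S.card = n ∧ S ⊆ Finset.Icc (-(n : ℤ) + 1) ((n : ℤ) - 1) ∧
    ∀ i : ℕ, i < n → i + 1 ≤ (S ∩ Finset.Icc (-(i : ℤ)) (i : ℤ)).card

/-! ### The Motzkin path of a centred Catalan set -/

/-- The `i`-th step `m_i(S) = |{-i, i} ∩ S| - 1` of the Motzkin path of `S`. -/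
def motzkinStep (S : Finset ℤ) (i : ℕ) : ℤ :=
  ((({-(i : ℤ), (i : ℤ)} : Finset ℤ) ∩ S).card : ℤ) - 1

/-- The height of the Motzkin path of `S` after `i` steps. -/
def motzkinHeight (S : Finset ℤ) (i : ℕ) : ℤ :=
  ∑ j ∈ Finset.Icc 1 i, motzkinStep S j

/-- The area between the Motzkin path of `S` (which has `|S| - 1` steps) and the `x`-axis: the
`i`-th step bounds a trapezium of width `1` whose parallel sides are the heights before and after
this step. -/
def motzkinArea (S : Finset ℤ) : ℚ :=
  ∑ i ∈ Finset.Icc 1 (S.card - 1),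
    ((motzkinHeight S (i - 1) : ℚ) + (motzkinHeight S i : ℚ)) / 2

/-! ### Alternating sign trapezoids -/

/-- `A` is an `(n, l)`-AS-trapezoid. The entry in row `i` (rows are labelled `1, …, n` from bottom
to top) and in the column with label `j` (columns are labelled `-n+1, …, l+n-1` from left to
right) is `A i j`. Row `i` occupies the columns `-i+1, …, l+i-1`. Outside of the trapezoid the
array is extended by zeros, so that arrays of trapezoidal shape correspond bijectively to functions
that satisfy `support`. -/
structure IsASTrapezoid (n l : ℕ) (A : ℕ → ℤ → ℤ) : Prop where
  /-- there are no entries outside of the trapezoidal shape -/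
  support : ∀ i j, A i j ≠ 0 →
    (1 ≤ i ∧ i ≤ n) ∧ (-(i : ℤ) + 1 ≤ j ∧ j ≤ (l : ℤ) + (i : ℤ) - 1)
  /-- the entries are `-1`, `0` or `1` -/
  entries : ∀ i j, A i j = -1 ∨ A i j = 0 ∨ A i j = 1
  /-- all row-sums are `1` -/
  row_sum : ∀ i : ℕ, 1 ≤ i → i ≤ n →
    ∑ j ∈ Finset.Icc (-(i : ℤ) + 1) ((l : ℤ) + (i : ℤ) - 1), A i j = 1
  /-- the sums of the central `l - 1` columns are `0` -/
  central_col_sum : ∀ j : ℤ, 1 ≤ j → j ≤ (l : ℤ) - 1 → ∑ i ∈ Finset.Icc 1 n, A i j = 0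
  /-- consecutive non-zero entries of a row have opposite signs -/
  row_alternating : ∀ (i : ℕ) (j j' : ℤ), j < j' → A i j ≠ 0 → A i j' ≠ 0 →
    (∀ k, j < k → k < j' → A i k = 0) → A i j' = -A i j
  /-- consecutive non-zero entries of a column have opposite signs -/
  col_alternating : ∀ (i i' : ℕ) (j : ℤ), i < i' → A i j ≠ 0 → A i' j ≠ 0 →
    (∀ k, i < k → k < i' → A k j = 0) → A i' j = -A i j
  /-- in every column the first non-zero entry from the top is positive -/
  top_positive : ∀ (i : ℕ) (j : ℤ), A i j ≠ 0 → (∀ k, i < k → A k j = 0) → 0 < A i j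

/-- There are only finitely many `(n, l)`-AS-trapezoids. -/
theorem finite_setOf_isASTrapezoid (n l : ℕ) : {A | IsASTrapezoid n l A}.Finite := by
  let I : Finset (ℕ × ℤ) := Finset.Icc 1 n ×ˢ Finset.Icc (-(n : ℤ)) ((l : ℤ) + n)
  let r : (ℕ → ℤ → ℤ) → (I → ℤ) := fun A c => A c.1.1 c.1.2
  have h1 : (Set.pi Set.univ (fun _ : I => (Set.Icc (-1) 1 : Set ℤ))).Finite :=
    Set.Finite.pi fun _ => Set.finite_Icc _ _
  refine Set.Finite.of_finite_image (f := r) (h1.subset ?_) ?_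
  · rintro _ ⟨A, hA, rfl⟩ c -
    have := hA.entries c.1.1 c.1.2
    simp only [r, Set.mem_Icc]
    omega
  · intro A hA B hB hAB
    funext i j
    by_cases hc : (i, j) ∈ I
    · exact congrFun hAB ⟨(i, j), hc⟩
    · have key : ∀ C, IsASTrapezoid n l C → C i j = 0 := by
        intro C hC
        by_contra h
        have := hC.support i j h
        apply hc
        simp only [I, Finset.mem_product, Finset.mem_Icc]
        omega
      rw [key A hA, key B hB]

/-- The relabelling of the columns: subtract `1` from non-positive labels and `l - 1` from positive
labels. -/
def shiftLabel (l : ℕ) (j : ℤ) : ℤ :=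
  if j ≤ 0 then j - 1 else j - ((l : ℤ) - 1)

/-- The set associated with an `(n, l)`-AS-trapezoid `A`: the relabelled columns with positive
column-sum, together with `0`. -/
noncomputable def associatedSet (n l : ℕ) (A : ℕ → ℤ → ℤ) : Finset ℤ :=
  insert 0 (((Finset.Icc (-(n : ℤ) + 1) ((l : ℤ) + (n : ℤ) - 1)).filter
    (fun j => 0 < ∑ i ∈ Finset.Icc 1 n, A i j)).image (shiftLabel l))

/-- The weight `w_l(S)`: the number of `(n, l)`-AS-trapezoids with associated set `S`, where
`n = |S| - 1`. -/
noncomputable def weight (l : ℕ) (S : Finset ℤ) : ℕ :=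
  {A | IsASTrapezoid (S.card - 1) l A ∧ associatedSet (S.card - 1) l A = S}.ncard

/-! ### The skew shape of a centred Catalan set -/

/-- The negative elements `s_1 < … < s_u` of `S`. -/
def negPart (S : Finset ℤ) : Finset ℤ := S.filter (fun x => x < 0)

/-- The positive elements `s_{u+1} < … < s_n` of `S`. -/
def posPart (S : Finset ℤ) : Finset ℤ := S.filter (fun x => 0 < x)

/-- The list `(-s_1 - u, …, -s_u - 1)`. Its entries are non-negative integers for every `S`. -/
def muParts (S : Finset ℤ) : List ℕ :=
  List.ofFn fun i : Fin (negPart S).card =>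
    (-(negPart S).orderEmbOfFin rfl i - (((negPart S).card : ℤ) - (i : ℤ))).toNat

/-- The list `(u + 1 - s_{u+1}, …, n - s_n)`. Its entries are non-negative integers if `S` is a
centred Catalan set of size `n + 1`. -/
def lamConjParts (S : Finset ℤ) : List ℕ :=
  List.ofFn fun j : Fin (posPart S).card =>
    (((negPart S).card : ℤ) + (j : ℤ) + 1 - (posPart S).orderEmbOfFin rfl j).toNat

theorem sub_le_orderEmbOfFin_sub (T : Finset ℤ) {i j : Fin T.card} (h : i ≤ j) :
    ((j : ℕ) : ℤ) - ((i : ℕ) : ℤ) ≤ T.orderEmbOfFin rfl j - T.orderEmbOfFin rfl i := by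
  obtain ⟨i, hi⟩ := i
  obtain ⟨j, hj⟩ := j
  have h' : i ≤ j := h
  clear h
  induction j, h' using Nat.le_induction with
  | base => simp
  | succ k hk ih =>
    have h1 := ih (by omega)
    have h2 : T.orderEmbOfFin rfl ⟨k, by omega⟩ < T.orderEmbOfFin rfl ⟨k + 1, hj⟩ :=
      (T.orderEmbOfFin rfl).strictMono (by simp)
    simp only at h1 ⊢
    push_cast
    omega

theorem muParts_sortedGE (S : Finset ℤ) : (muParts S).SortedGE := by
  refine Antitone.sortedGE_ofFn fun i j h => Int.toNat_le_toNat ?_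
  have := sub_le_orderEmbOfFin_sub (negPart S) h
  omega

theorem lamConjParts_sortedGE (S : Finset ℤ) : (lamConjParts S).SortedGE := by
  refine Antitone.sortedGE_ofFn fun i j h => Int.toNat_le_toNat ?_
  have := sub_le_orderEmbOfFin_sub (posPart S) h
  omega

/-- The Young diagram `λ(S) = (u + 1 - s_{u+1}, …, n - s_n)'`, where `'` denotes conjugation. -/
def lam (S : Finset ℤ) : YoungDiagram :=
  (YoungDiagram.ofRowLens (lamConjParts S) (lamConjParts_sortedGE S)).transpose

/-- The Young diagram `μ(S) = (-s_1 - u, …, -s_u - 1)`. -/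
def mu (S : Finset ℤ) : YoungDiagram :=
  YoungDiagram.ofRowLens (muParts S) (muParts_sortedGE S)

/-- The cells (row, column) of the skew shape `κ / ν`. -/
def skewCells (κ ν : YoungDiagram) : Finset (ℕ × ℕ) := κ.cells \ ν.cells

/-- The number `f^{κ/ν}` of standard Young tableaux of skew shape `κ / ν`: the bijections from the
cells to `{1, …, |κ/ν|}` that increase strictly along rows and down columns. -/
noncomputable def numSkewSYT (κ ν : YoungDiagram) : ℕ :=
  Nat.card {T : ↥(skewCells κ ν) ≃ ↥(Finset.Icc 1 (skewCells κ ν).card) //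
    (∀ c d : ↥(skewCells κ ν), c.1.1 = d.1.1 → c.1.2 < d.1.2 → T c < T d) ∧
    (∀ c d : ↥(skewCells κ ν), c.1.2 = d.1.2 → c.1.1 < d.1.1 → T c < T d)}

end CentredCatalan

namespace CentredCatalan

/-! ### Alternating sequences and their partial sums -/

/-! For an array and each `i`, let `t i` be the list of columns within the span of row `i` whose
entries above row `i` sum to 1. Column alternation with positive top entries says that all such
upper sums are 0 or 1, and for a column outside that span the upper sum is the full column sum,
which `S` dictates. So row `i + 1` is the indicator of `t i`, augmented by those outermost columns
of that row that belong to `S`, minus the indicator of `t (i + 1)`. It alternates with sum 1 exactly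
if `t (i + 1)` interlaces the augmented list. Hence the weight counts chains of interlacing strictly
increasing lists (`weight_eq_ncard_chains`), and the length of `t i` is the height of the Motzkin
path after `i` steps (`IsMonotoneChain.length`).

Polynomiality: count chains backwards from the last list. One step sums a polynomial over all strict
lists interlacing a given one, and summing over integer intervals preserves polynomiality
(`sum_interlacing_mem_polyFunOn`, `exists_polynomial_weight`).

Leading term: the diagonal of `λ / μ` with index `i` has as many cells as the height after `i` steps
(`mem_skewCells`), so the cells match the entries of a chain, and their number is the area.
Interlacing becomes weak increase along rows and columns. Every chain thus gives a weakly increasing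
filling with entries in `[-n, l + n]`, and every strictly increasing filling with entries in `[1,
l]` comes from a chain. A strict filling with distinct entries is a standard tableau together with
its set of values, while among all `d`-cell fillings those with a repeated entry number only `O(l ^
(d - 1))`. So `weight_le` and `le_weight` squeeze the weight divided by `l ^ d` to `f / d!`. As `f >
0`, this limit determines degree and leading coefficient of the polynomial
(`degree_and_leadingCoeff_of_tendsto`). -/

theorem sum_Icc_add_one (f : ℤ → ℤ) {a j : ℤ} (h : a ≤ j + 1) :
    ∑ x ∈ Finset.Icc a (j + 1), f x = ∑ x ∈ Finset.Icc a j, f x + f (j + 1) := by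
  have : Finset.Icc a (j + 1) = insert (j + 1) (Finset.Icc a j) := by
    ext x; simp only [Finset.mem_insert, Finset.mem_Icc]; omega
  rw [this, Finset.sum_insert (by simp), add_comm]

theorem sum_Ioc_split (f : ℕ → ℤ) {i m n : ℕ} (h : i ≤ m) (h' : m ≤ n) :
    ∑ x ∈ Finset.Ioc i n, f x = ∑ x ∈ Finset.Ioc i m, f x + ∑ x ∈ Finset.Ioc m n, f x := by
  have : Finset.Ioc i n = Finset.Ioc i m ∪ Finset.Ioc m n := by
    ext x; simp only [Finset.mem_union, Finset.mem_Ioc]; omega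
  rw [this, Finset.sum_union]
  rw [Finset.disjoint_left]
  intro x
  simp only [Finset.mem_Ioc]
  omega

theorem sum_Ioc_eq_add (f : ℕ → ℤ) {i n : ℕ} (h : i < n) :
    ∑ x ∈ Finset.Ioc i n, f x = f (i + 1) + ∑ x ∈ Finset.Ioc (i + 1) n, f x := by
  rw [sum_Ioc_split f (show i ≤ i + 1 by omega) (show i + 1 ≤ n by omega)]
  simp

/-- Consecutive non-zero entries cancel, so a sum over an interval is either 0 or the last non-zero
entry met. This is the invariant `key`, on intervals that are empty for `m = 0`. -/
theorem sum_Icc_mem_of_alternating {f : ℤ → ℤ} (hent : ∀ j, f j = -1 ∨ f j = 0 ∨ f j = 1)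
    (halt : ∀ j j' : ℤ, j < j' → f j ≠ 0 → f j' ≠ 0 → (∀ k, j < k → k < j' → f k = 0) →
      f j' = -f j) (a b : ℤ) :
    ∑ x ∈ Finset.Icc a b, f x = -1 ∨ ∑ x ∈ Finset.Icc a b, f x = 0 ∨
      ∑ x ∈ Finset.Icc a b, f x = 1 := by
  have key : ∀ m : ℕ, ((∀ k, a ≤ k → k ≤ a - 1 + m → f k = 0) ∧
        ∑ x ∈ Finset.Icc a (a - 1 + m), f x = 0) ∨
      ∃ k, k ≤ a - 1 + m ∧ f k ≠ 0 ∧ (∀ k', k < k' → k' ≤ a - 1 + m → f k' = 0) ∧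
        (∑ x ∈ Finset.Icc a (a - 1 + m), f x = 0 ∨
          ∑ x ∈ Finset.Icc a (a - 1 + m), f x = f k) := by
    intro m
    induction m with
    | zero =>
      left
      refine ⟨fun k h h' => by push_cast at h'; omega, ?_⟩
      rw [Finset.Icc_eq_empty (by push_cast; omega), Finset.sum_empty]
    | succ m ih =>
      have e : (a - 1 + ((m + 1 : ℕ) : ℤ)) = (a - 1 + m) + 1 := by push_cast; ring
      rw [e, sum_Icc_add_one f (by omega)]
      set y : ℤ := a - 1 + m with hy
      by_cases h0 : f (y + 1) = 0
      · rw [h0, add_zero]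
        rcases ih with ⟨h1, h2⟩ | ⟨k, hk, hk0, h1, h2⟩
        · left
          refine ⟨fun k hk hk' => ?_, h2⟩
          rcases eq_or_lt_of_le hk' with rfl | h
          · exact h0
          · exact h1 k hk (by omega)
        · right
          refine ⟨k, by omega, hk0, fun k' h h' => ?_, h2⟩
          rcases eq_or_lt_of_le h' with rfl | h''
          · exact h0
          · exact h1 k' h (by omega)
      · right
        refine ⟨y + 1, le_rfl, h0, fun k' h h' => by omega, ?_⟩
        rcases ih with ⟨h1, h2⟩ | ⟨k, hk, hk0, h1, h2⟩
        · right; rw [h2, zero_add]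
        · have := halt k (y + 1) (by omega) hk0 h0 fun k' h h' => h1 k' h (by omega)
          rcases h2 with h2 | h2 <;> omega
  rcases lt_or_ge b a with h | h
  · rw [Finset.Icc_eq_empty (by omega), Finset.sum_empty]; simp
  · have := key (b - a + 1).toNat
    rw [show a - 1 + ((b - a + 1).toNat : ℤ) = b by omega] at this
    rcases this with ⟨-, h2⟩ | ⟨k, -, -, -, h2 | h2⟩
    · simp [h2]
    · simp [h2]
    · rw [h2]; exact hent k

/-- The partial sums of an alternating sequence with sum `1` are `0` or `1`. -/
theorem prefix_sum_of_alternating {f : ℤ → ℤ} (hent : ∀ j, f j = -1 ∨ f j = 0 ∨ f j = 1)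
    (halt : ∀ j j' : ℤ, j < j' → f j ≠ 0 → f j' ≠ 0 → (∀ k, j < k → k < j' → f k = 0) →
      f j' = -f j) {a b : ℤ} (hb : ∀ j, b < j → f j = 0)
    (hsum : ∑ x ∈ Finset.Icc a b, f x = 1) (j : ℤ) :
    ∑ x ∈ Finset.Icc a j, f x = 0 ∨ ∑ x ∈ Finset.Icc a j, f x = 1 := by
  rcases lt_or_ge j a with h | h
  · left; rw [Finset.Icc_eq_empty (by omega), Finset.sum_empty]
  rcases le_or_gt b j with h' | h'
  · right
    rw [← hsum]
    refine (Finset.sum_subset (Finset.Icc_subset_Icc_right h') fun x hx hx' => hb x ?_).symm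
    simp only [Finset.mem_Icc] at hx hx'
    omega
  · have e : ∑ x ∈ Finset.Icc a b, f x =
        ∑ x ∈ Finset.Icc a j, f x + ∑ x ∈ Finset.Icc (j + 1) b, f x := by
      have : Finset.Icc a b = Finset.Icc a j ∪ Finset.Icc (j + 1) b := by
        ext x; simp only [Finset.mem_union, Finset.mem_Icc]; omega
      rw [this, Finset.sum_union]
      rw [Finset.disjoint_left]
      intro x
      simp only [Finset.mem_Icc]
      omega
    -- The initial and the final segment both have sums in {-1, 0, 1} and together give 1, so
    -- neither can be -1.
    have h1 := sum_Icc_mem_of_alternating hent halt a j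
    have h2 := sum_Icc_mem_of_alternating hent halt (j + 1) b
    omega

/-- A sequence whose partial sums are `0` or `1` is alternating. -/
theorem alternating_of_prefix_sum {f : ℤ → ℤ} {a : ℤ} (ha : ∀ j, j < a → f j = 0)
    (hp : ∀ j, ∑ x ∈ Finset.Icc a j, f x = 0 ∨ ∑ x ∈ Finset.Icc a j, f x = 1)
    (j j' : ℤ) (hjj : j < j') (hj : f j ≠ 0) (hj' : f j' ≠ 0)
    (h0 : ∀ k, j < k → k < j' → f k = 0) : f j' = -f j := by
  have h1 : a ≤ j := by by_contra h; exact hj (ha j (by omega))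
  have e1 := sum_Icc_add_one f (show a ≤ (j - 1) + 1 by omega)
  have e2 := sum_Icc_add_one f (show a ≤ (j' - 1) + 1 by omega)
  rw [sub_add_cancel] at e1 e2
  have e3 : ∑ x ∈ Finset.Icc a (j' - 1), f x = ∑ x ∈ Finset.Icc a j, f x := by
    refine (Finset.sum_subset (Finset.Icc_subset_Icc_right (by omega)) fun x hx hx' => ?_).symm
    simp only [Finset.mem_Icc] at hx hx'
    exact h0 x (by omega) (by omega)
  have := hp (j - 1)
  have := hp j
  have := hp j'
  omega

/-- If a sequence alternates and its last non-zero entry is positive, then the sums over its final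
segments are `0` or `1`. -/
theorem suffix_sum_of_alternating {f : ℕ → ℤ} {n : ℕ}
    (hent : ∀ i, f i = -1 ∨ f i = 0 ∨ f i = 1)
    (halt : ∀ i i' : ℕ, i < i' → f i ≠ 0 → f i' ≠ 0 → (∀ k, i < k → k < i' → f k = 0) →
      f i' = -f i)
    (htop : ∀ i, f i ≠ 0 → (∀ k, i < k → f k = 0) → 0 < f i) (hn : ∀ i, n < i → f i = 0)
    (i : ℕ) :
    ∑ x ∈ Finset.Ioc i n, f x = 0 ∨ ∑ x ∈ Finset.Ioc i n, f x = 1 := by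
  -- Here `k` is the lowest non-zero position of the segment. The equation says that the sum is 1 if
  -- this entry is 1, and 0 if it is -1.
  have key : ∀ m ≤ n, ((∀ k, n - m < k → f k = 0) ∧ ∑ x ∈ Finset.Ioc (n - m) n, f x = 0) ∨
      ∃ k, n - m < k ∧ f k ≠ 0 ∧ (∀ k', n - m < k' → k' < k → f k' = 0) ∧
        2 * ∑ x ∈ Finset.Ioc (n - m) n, f x = 1 + f k := by
    intro m
    induction m with
    | zero => intro _; left; simpa using hn
    | succ m ih =>
      intro hm
      rw [sum_Ioc_eq_add f (show n - (m + 1) < n by omega),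
        show n - (m + 1) + 1 = n - m by omega]
      have ih := ih (by omega)
      by_cases h0 : f (n - m) = 0
      · rw [h0, zero_add]
        rcases ih with ⟨h1, h2⟩ | ⟨k, hk, hk0, h1, h2⟩
        · left
          refine ⟨fun k hk => ?_, h2⟩
          rcases eq_or_ne k (n - m) with rfl | h
          · exact h0
          · exact h1 k (by omega)
        · right
          refine ⟨k, by omega, hk0, fun k' h h' => ?_, h2⟩
          rcases eq_or_ne k' (n - m) with rfl | h
          · exact h0
          · exact h1 k' (by omega) h'
      · right
        refine ⟨n - m, by omega, h0, fun k' h h' => by omega, ?_⟩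
        have := hent (n - m)
        rcases ih with ⟨h1, h2⟩ | ⟨k, hk, hk0, h1, h2⟩
        · have := htop (n - m) h0 h1
          omega
        · have := halt (n - m) k hk h0 hk0 h1
          omega
  rcases le_or_gt n i with h | h
  · left; rw [Finset.Ioc_eq_empty (by omega), Finset.sum_empty]
  · have := key (n - i) (by omega)
    rw [show n - (n - i) = i by omega] at this
    rcases this with ⟨-, h2⟩ | ⟨k, -, -, -, h2⟩
    · exact Or.inl h2
    · have := hent k
      omega

theorem eq_suffix_sum_sub (f : ℕ → ℤ) {n i : ℕ} (hi : 1 ≤ i) (hin : i ≤ n) :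
    f i = ∑ x ∈ Finset.Ioc (i - 1) n, f x - ∑ x ∈ Finset.Ioc i n, f x := by
  rw [sum_Ioc_eq_add f (show i - 1 < n by omega), show i - 1 + 1 = i by omega]
  ring

/-- The zeros in between make the sum beyond `i` equal to the sum from `i'` on. If this common value
is 1, the two entries are forced to be -1 and 1; if it is 0, they are 1 and -1. -/
theorem alternating_of_suffix_sum {f : ℕ → ℤ} {n : ℕ} (hn : ∀ i, f i ≠ 0 → 1 ≤ i ∧ i ≤ n)
    (hs : ∀ i, ∑ x ∈ Finset.Ioc i n, f x = 0 ∨ ∑ x ∈ Finset.Ioc i n, f x = 1)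
    (i i' : ℕ) (hii : i < i') (hi : f i ≠ 0) (hi' : f i' ≠ 0)
    (h0 : ∀ k, i < k → k < i' → f k = 0) : f i' = -f i := by
  have b1 := hn i hi
  have b2 := hn i' hi'
  have e1 := eq_suffix_sum_sub f b1.1 b1.2
  have e2 := eq_suffix_sum_sub f b2.1 b2.2
  have e3 := sum_Ioc_split f (show i ≤ i' - 1 by omega) (show i' - 1 ≤ n by omega)
  have e4 : ∑ x ∈ Finset.Ioc i (i' - 1), f x = 0 :=
    Finset.sum_eq_zero fun x hx => h0 x (Finset.mem_Ioc.1 hx).1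
      (by have := (Finset.mem_Ioc.1 hx).2; omega)
  have := hs i
  have := hs i'
  have := hs (i - 1)
  omega

theorem top_positive_of_suffix_sum {f : ℕ → ℤ} {n : ℕ} (hn : ∀ i, f i ≠ 0 → 1 ≤ i ∧ i ≤ n)
    (hs : ∀ i, ∑ x ∈ Finset.Ioc i n, f x = 0 ∨ ∑ x ∈ Finset.Ioc i n, f x = 1)
    (i : ℕ) (hi : f i ≠ 0) (h0 : ∀ k, i < k → f k = 0) : 0 < f i := by
  have b1 := hn i hi
  have e1 := eq_suffix_sum_sub f b1.1 b1.2
  rw [Finset.sum_eq_zero fun x hx => h0 x (Finset.mem_Ioc.1 hx).1] at e1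
  have := hs (i - 1)
  omega

/-! ### Interlacing lists -/

/-- The list `t` interlaces the list `u`: `u₀ ≤ t₀ ≤ u₁ ≤ t₁ ≤ ⋯ ≤ u_m`. -/
def Interlaces (u t : List ℤ) : Prop :=
  u.length = t.length + 1 ∧
    ∀ k < t.length, u.getD k 0 ≤ t.getD k 0 ∧ t.getD k 0 ≤ u.getD (k + 1) 0

theorem interlaces_singleton_nil (a : ℤ) : Interlaces [a] [] := by
  simp [Interlaces]

theorem interlaces_cons_cons {a b c : ℤ} {u t : List ℤ} :
    Interlaces (a :: b :: u) (c :: t) ↔ a ≤ c ∧ c ≤ b ∧ Interlaces (b :: u) t := by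
  simp only [Interlaces, List.length_cons, Nat.forall_lt_succ_left, List.getD_cons_zero,
    List.getD_cons_succ]
  constructor
  · rintro ⟨h, ⟨h1, h2⟩, h3⟩
    exact ⟨h1, h2, by omega, h3⟩
  · rintro ⟨h1, h2, h, h3⟩
    exact ⟨by omega, ⟨h1, h2⟩, h3⟩

/-- The number of entries of `t` that are at most `j`. -/
def countLE (t : List ℤ) (j : ℤ) : ℕ := t.countP (· ≤ j)

/-- Translates between the entries of a strict list and its counting function; interlacing becomes a
pointwise comparison of counting functions, which are what row sums compute. -/
theorem getD_le_iff_lt_countLE {t : List ℤ} (ht : t.Pairwise (· < ·)) {k : ℕ}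
    (hk : k < t.length) (j : ℤ) : t.getD k 0 ≤ j ↔ k < countLE t j := by
  induction t generalizing k with
  | nil => simp at hk
  | cons a t ih =>
    rw [List.pairwise_cons] at ht
    simp only [countLE, List.countP_cons] at ih ⊢
    cases k with
    | zero =>
      simp only [List.getD_cons_zero]
      by_cases h : a ≤ j
      · simp [h]
      · have : List.countP (fun x => decide (x ≤ j)) t = 0 := by
          rw [List.countP_eq_zero]
          intro x hx
          have := ht.1 x hx
          simp only [decide_eq_true_eq]
          omega
        simp [h, this]
    | succ k =>
      simp only [List.length_cons, Nat.add_lt_add_iff_right] at hk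
      rw [List.getD_cons_succ, ih ht.2 hk]
      by_cases h : a ≤ j
      · simp [h]
      · have : List.countP (fun x => decide (x ≤ j)) t = 0 := by
          rw [List.countP_eq_zero]
          intro x hx
          have := ht.1 x hx
          simp only [decide_eq_true_eq]
          omega
        simp [h, this]

theorem countLE_le_length (t : List ℤ) (j : ℤ) : countLE t j ≤ t.length :=
  List.countP_le_length

theorem countLE_eq_length {t : List ℤ} {j : ℤ} (h : ∀ x ∈ t, x ≤ j) :
    countLE t j = t.length := by
  rw [countLE, List.countP_eq_length]
  simpa using h

/-- Interlacing in terms of counting functions. -/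
theorem interlaces_iff_countLE {u t : List ℤ} (hu : u.Pairwise (· < ·))
    (ht : t.Pairwise (· < ·)) :
    Interlaces u t ↔ u.length = t.length + 1 ∧
      ∀ j, countLE t j ≤ countLE u j ∧ countLE u j ≤ countLE t j + 1 := by
  refine and_congr_right fun hlen => ⟨fun h j => ⟨?_, ?_⟩, fun h k hk => ⟨?_, ?_⟩⟩
  · by_contra hc
    have h1 := countLE_le_length t j
    have hk : countLE u j < t.length := by omega
    have h2 := (getD_le_iff_lt_countLE ht hk j).2 (by omega)
    have h3 := (h _ hk).1
    have := (getD_le_iff_lt_countLE hu (show countLE u j < u.length by omega) j).1 (by omega)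
    omega
  · by_contra hc
    have h1 := countLE_le_length u j
    have hk : countLE t j < t.length := by omega
    have h2 := (getD_le_iff_lt_countLE hu (show countLE t j + 1 < u.length by omega) j).2
      (by omega)
    have h3 := (h _ hk).2
    have := (getD_le_iff_lt_countLE ht hk j).1 (by omega)
    omega
  · rw [getD_le_iff_lt_countLE hu (by omega)]
    have := (getD_le_iff_lt_countLE ht hk (t.getD k 0)).1 le_rfl
    have := (h (t.getD k 0)).1
    omega
  · rw [getD_le_iff_lt_countLE ht hk]
    have := (getD_le_iff_lt_countLE hu (show k + 1 < u.length by omega) (u.getD (k + 1) 0)).1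
      le_rfl
    have := (h (u.getD (k + 1) 0)).2
    omega

/-- The indicator function of a list. -/
def ind (t : List ℤ) (j : ℤ) : ℤ := if j ∈ t then 1 else 0

theorem ind_mem (t : List ℤ) (j : ℤ) : ind t j = 0 ∨ ind t j = 1 := by
  rw [ind]; split_ifs <;> simp

theorem sum_ind_Icc {t : List ℤ} (ht : t.Pairwise (· < ·)) {a : ℤ} (ha : ∀ x ∈ t, a ≤ x)
    (j : ℤ) : ∑ x ∈ Finset.Icc a j, ind t x = countLE t j := by
  have hn : t.Nodup := ht.imp fun h => ne_of_lt h
  simp only [ind]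
  rw [Finset.sum_boole, countLE, List.countP_eq_length_filter,
    ← List.toFinset_card_of_nodup (hn.filter _)]
  congr 2
  ext x
  simp only [Finset.mem_filter, Finset.mem_Icc, List.mem_toFinset, List.mem_filter,
    decide_eq_true_eq]
  exact ⟨fun h => ⟨h.2, h.1.2⟩, fun h => ⟨⟨ha x h.1, h.2⟩, h.1⟩⟩

theorem eq_of_ind_eq {t t' : List ℤ} (ht : t.Pairwise (· < ·)) (ht' : t'.Pairwise (· < ·))
    (h : ∀ j, ind t j = ind t' j) : t = t' := by
  have hn : t.Nodup := ht.imp fun h => ne_of_lt h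
  have hn' : t'.Nodup := ht'.imp fun h => ne_of_lt h
  refine List.Perm.eq_of_pairwise (fun a b _ _ h h' => absurd h' (not_lt.2 h.le)) ht ht' ?_
  rw [List.perm_ext_iff_of_nodup hn hn']
  intro j
  have := h j
  simp only [ind] at this
  by_cases h1 : j ∈ t <;> by_cases h2 : j ∈ t' <;> simp_all

theorem mem_bounds_of_interlaces {u t : List ℤ} (h : Interlaces u t) {a b : ℤ}
    (hu : ∀ x ∈ u, a ≤ x ∧ x ≤ b) : ∀ x ∈ t, a ≤ x ∧ x ≤ b := by
  intro x hx
  obtain ⟨k, hk, rfl⟩ := List.mem_iff_getElem.1 hx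
  have h1 := h.2 k hk
  have hl := h.1
  rw [List.getD_eq_getElem _ _ (show k < u.length by omega), List.getD_eq_getElem _ _ hk,
    List.getD_eq_getElem _ _ (show k + 1 < u.length by omega)] at h1
  have h2 := hu _ (List.getElem_mem (show k < u.length by omega))
  have h3 := hu _ (List.getElem_mem (show k + 1 < u.length by omega))
  omega

/-! ### Enumeration of strict interlacing lists -/

/-- The strictly increasing lists that interlace `lo :: vs`. -/
noncomputable def fill : ℤ → List ℤ → Finset (List ℤ)
  | _, [] => {[]}
  | lo, v :: vs =>
    (Finset.Ico lo v).biUnion (fun x => (fill v vs).image (fun t => x :: t)) ∪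
      (fill (v + 1) vs).image (fun t => v :: t)

/-- The first entry lies in `[lo, v]`. If it is below `v`, strictness imposes nothing new and the
tail starts at `v`; if it equals `v`, strictness raises the lower bound for the tail to `v + 1`.
Hence the two branches of `fill`. -/
theorem mem_fill {lo : ℤ} {vs : List ℤ} (hvs : vs.Pairwise (· < ·)) (hlo : ∀ v ∈ vs, lo ≤ v)
    (t : List ℤ) : t ∈ fill lo vs ↔ Interlaces (lo :: vs) t ∧ t.Pairwise (· < ·) := by
  induction vs generalizing lo t with
  | nil =>
    simp only [fill, Finset.mem_singleton]
    constructor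
    · rintro rfl
      exact ⟨interlaces_singleton_nil lo, List.Pairwise.nil⟩
    · rintro ⟨h, -⟩
      have := h.1
      simp only [List.length_cons, List.length_nil, zero_add, right_eq_add,
        List.length_eq_zero_iff] at this
      exact this
  | cons v vs ih =>
    rw [List.pairwise_cons] at hvs
    cases t with
    | nil =>
      simp only [fill, Finset.mem_union, Finset.mem_biUnion, Finset.mem_image, reduceCtorEq,
        and_false, exists_false, false_or, false_iff, not_and]
      intro h
      have := h.1
      simp at this
    | cons x t =>
      rw [interlaces_cons_cons, List.pairwise_cons]
      simp only [fill, Finset.mem_union, Finset.mem_biUnion, Finset.mem_image, List.cons.injEq,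
        Finset.mem_Ico]
      have head : ∀ w, Interlaces (w :: vs) t → t.Pairwise (· < ·) → ∀ y ∈ t, w ≤ y := by
        intro w h1 h2 y hy
        cases t with
        | nil => simp at hy
        | cons z t =>
          have h3 := (h1.2 0 (by simp)).1
          simp only [List.getD_cons_zero] at h3
          rw [List.pairwise_cons] at h2
          rcases List.mem_cons.1 hy with rfl | hy
          · exact h3
          · exact h3.trans (h2.1 y hy).le
      have change : (∀ y ∈ t, v < y) → Interlaces (v :: vs) t → Interlaces ((v + 1) :: vs) t := by
        intro h1 h2
        refine ⟨h2.1, fun k hk => ⟨?_, (h2.2 k hk).2⟩⟩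
        have := (h2.2 k hk).1
        cases k with
        | zero =>
          have h3 := h1 _ (List.getElem_mem hk)
          rw [List.getD_eq_getElem _ _ hk]
          simpa using h3
        | succ k => simpa using this
      constructor
      · rintro (⟨y, hy, t', ht', rfl, rfl⟩ | ⟨t', ht', rfl, rfl⟩)
        · rw [ih hvs.2 (fun w hw => (hvs.1 w hw).le)] at ht'
          refine ⟨⟨hy.1, hy.2.le, ht'.1⟩, fun z hz => ?_, ht'.2⟩
          have := head v ht'.1 ht'.2 z hz
          omega
        · rw [ih hvs.2 (fun w hw => by have := hvs.1 w hw; omega)] at ht'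
          have h1 := head _ ht'.1 ht'.2
          refine ⟨⟨hlo v (by simp), le_rfl, ht'.1.1, fun k hk => ⟨?_, (ht'.1.2 k hk).2⟩⟩,
            fun z hz => ?_, ht'.2⟩
          · have := (ht'.1.2 k hk).1
            cases k with
            | zero => simp only [List.getD_cons_zero] at this ⊢; omega
            | succ k => simpa using this
          · have := h1 z hz
            omega
      · rintro ⟨⟨h1, h2, h3⟩, h4, h5⟩
        rcases eq_or_lt_of_le h2 with rfl | h2
        · right
          refine ⟨t, ?_, rfl, rfl⟩
          rw [ih hvs.2 (fun w hw => by have := hvs.1 w hw; omega)]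
          exact ⟨change h4 h3, h5⟩
        · left
          refine ⟨x, ⟨h1, h2⟩, t, ?_, rfl, rfl⟩
          rw [ih hvs.2 (fun w hw => (hvs.1 w hw).le)]
          exact ⟨h3, h5⟩

theorem sum_fill_cons (lo v : ℤ) (vs : List ℤ) (f : List ℤ → ℚ) :
    ∑ t ∈ fill lo (v :: vs), f t = ∑ x ∈ Finset.Ico lo v, ∑ t ∈ fill v vs, f (x :: t) +
      ∑ t ∈ fill (v + 1) vs, f (v :: t) := by
  have inj : ∀ x : ℤ, Function.Injective (fun t : List ℤ => x :: t) := fun x =>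
    List.cons_injective
  rw [fill, Finset.sum_union, Finset.sum_biUnion]
  · rw [Finset.sum_image ((inj v).injOn)]
    congr 1
    exact Finset.sum_congr rfl fun x _ => Finset.sum_image ((inj x).injOn)
  · intro x _ y _ hxy
    rw [Function.onFun, Finset.disjoint_left]
    intro t ht ht'
    obtain ⟨s, -, rfl⟩ := Finset.mem_image.1 ht
    obtain ⟨s', -, h⟩ := Finset.mem_image.1 ht'
    exact hxy (List.cons.inj h).1.symm
  · rw [Finset.disjoint_left]
    intro t ht ht'
    obtain ⟨x, hx, ht⟩ := Finset.mem_biUnion.1 ht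
    obtain ⟨s, -, rfl⟩ := Finset.mem_image.1 ht
    obtain ⟨s', -, h⟩ := Finset.mem_image.1 ht'
    have := (List.cons.inj h).1
    simp only [Finset.mem_Ico] at hx
    omega

/-! ### Chains of interlacing lists -/

/-- Add to the list `t` the outermost columns `-i+1` and `l+i-1` of the `i`-th row if these belong
to elements of `S`. -/
def augment (S : Finset ℤ) (l i : ℕ) (t : List ℤ) : List ℤ :=
  (if -(i : ℤ) ∈ S then [-(i : ℤ) + 1] else []) ++ t ++
    (if (i : ℤ) ∈ S then [(l : ℤ) + i - 1] else [])

/-- One step of a chain of interlacing lists. -/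
def IsStep (S : Finset ℤ) (l i : ℕ) (t t' : List ℤ) : Prop :=
  Interlaces (augment S l i t) t' ∧ t'.Pairwise (· < ·)

/-- The `i`-th member of a chain records the columns which contribute a one to the `i` bottom
rows. -/
def IsMonotoneChain (S : Finset ℤ) (n l : ℕ) (t : ℕ → List ℤ) : Prop :=
  t 0 = [] ∧ (∀ i < n, IsStep S l (i + 1) (t i) (t (i + 1))) ∧ ∀ i, n < i → t i = []

/-- The lists which are admissible as `i`-th member of a chain. -/
def IsAdmissible (l i : ℕ) (t : List ℤ) : Prop :=
  t.Pairwise (· < ·) ∧ ∀ x ∈ t, -(i : ℤ) + 1 ≤ x ∧ x ≤ (l : ℤ) + i - 1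

theorem mem_augment {S : Finset ℤ} {l i : ℕ} {t : List ℤ} {x : ℤ} :
    x ∈ augment S l i t ↔ x ∈ t ∨ (x = -(i : ℤ) + 1 ∧ -(i : ℤ) ∈ S) ∨
      (x = (l : ℤ) + i - 1 ∧ (i : ℤ) ∈ S) := by
  by_cases h1 : -(i : ℤ) ∈ S <;> by_cases h2 : (i : ℤ) ∈ S <;> simp [augment, h1, h2] <;> tauto

/-- The added columns `-i` and `l + i` lie just outside the span of row `i`. The bound `1 ≤ l` keeps
them distinct and in order even for `i = 0` and an empty list. -/
theorem isAdmissible_augment {S : Finset ℤ} {l i : ℕ} (hl : 1 ≤ l) {t : List ℤ}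
    (ht : IsAdmissible l i t) : IsAdmissible l (i + 1) (augment S l (i + 1) t) := by
  obtain ⟨ht1, ht2⟩ := ht
  refine ⟨?_, fun x hx => ?_⟩
  · simp only [augment]
    rw [List.pairwise_append, List.pairwise_append]
    refine ⟨⟨by split_ifs <;> simp, ht1, fun x hx y hy => ?_⟩, by split_ifs <;> simp,
      fun x hx y hy => ?_⟩
    · have := ht2 y hy
      split_ifs at hx <;> simp at hx
      omega
    · have : x ≤ (l : ℤ) + i - 1 := by
        rcases List.mem_append.1 hx with h | h
        · split_ifs at h <;> simp at h
          omega
        · exact (ht2 x h).2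
      split_ifs at hy <;> simp at hy
      omega
  · push_cast
    rcases mem_augment.1 hx with h | ⟨h, -⟩ | ⟨h, -⟩
    · have := ht2 x h
      omega
    · push_cast at h; omega
    · push_cast at h; omega

theorem isAdmissible_of_isStep {S : Finset ℤ} {l i : ℕ} (hl : 1 ≤ l) {t t' : List ℤ}
    (ht : IsAdmissible l i t) (h : IsStep S l (i + 1) t t') : IsAdmissible l (i + 1) t' :=
  ⟨h.2, mem_bounds_of_interlaces h.1 (isAdmissible_augment hl ht).2⟩

theorem isAdmissible_nil (l i : ℕ) : IsAdmissible l i [] := by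
  simp [IsAdmissible]

theorem IsMonotoneChain.isAdmissible {S : Finset ℤ} {n l : ℕ} {t : ℕ → List ℤ} (hl : 1 ≤ l)
    (h : IsMonotoneChain S n l t) (i : ℕ) : IsAdmissible l i (t i) := by
  induction i with
  | zero => rw [h.1]; exact isAdmissible_nil l 0
  | succ i ih =>
    rcases lt_or_ge i n with hi | hi
    · exact isAdmissible_of_isStep hl ih (h.2.1 i hi)
    · rw [h.2.2 (i + 1) (by omega)]; exact isAdmissible_nil l _

/-! ### Counting the elements of a centred Catalan set -/

/-- The number of elements of `S` in `{-i, …, -1}`. -/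
def negCount (S : Finset ℤ) (i : ℕ) : ℕ := (S.filter fun x => -(i : ℤ) ≤ x ∧ x < 0).card

/-- The number of elements of `S` in `{1, …, i}`. -/
def posCount (S : Finset ℤ) (i : ℕ) : ℕ := (S.filter fun x => 0 < x ∧ x ≤ (i : ℤ)).card

theorem negCount_zero (S : Finset ℤ) : negCount S 0 = 0 := by
  rw [negCount, Finset.card_eq_zero, Finset.filter_eq_empty_iff]
  intro x _
  push_cast
  omega

theorem posCount_zero (S : Finset ℤ) : posCount S 0 = 0 := by
  rw [posCount, Finset.card_eq_zero, Finset.filter_eq_empty_iff]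
  intro x _
  push_cast
  omega

theorem negCount_succ (S : Finset ℤ) (i : ℕ) :
    negCount S (i + 1) = negCount S i + if -((i + 1 : ℕ) : ℤ) ∈ S then 1 else 0 := by
  unfold negCount
  split_ifs with h
  · rw [← Finset.card_insert_of_notMem (a := -((i + 1 : ℕ) : ℤ))]
    · congr 1
      ext x
      simp only [Finset.mem_filter, Finset.mem_insert]
      by_cases hx : x = -((i + 1 : ℕ) : ℤ)
      · exact ⟨fun _ => Or.inl hx, fun _ => ⟨hx ▸ h, by push_cast at *; omega⟩⟩
      · constructor
        · rintro ⟨h1, h2⟩; right; exact ⟨h1, by push_cast at *; omega, h2.2⟩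
        · rintro (h1 | ⟨h1, h2⟩)
          · exact absurd h1 hx
          · exact ⟨h1, by push_cast at *; omega, h2.2⟩
    · simp
  · rw [add_zero]
    congr 1
    ext x
    simp only [Finset.mem_filter]
    by_cases hx : x = -((i + 1 : ℕ) : ℤ)
    · exact iff_of_false (fun hh => h (hx ▸ hh.1)) fun hh => h (hx ▸ hh.1)
    · refine and_congr_right fun _ => ?_
      push_cast at *
      omega

theorem posCount_succ (S : Finset ℤ) (i : ℕ) :
    posCount S (i + 1) = posCount S i + if ((i + 1 : ℕ) : ℤ) ∈ S then 1 else 0 := by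
  unfold posCount
  split_ifs with h
  · rw [← Finset.card_insert_of_notMem (a := ((i + 1 : ℕ) : ℤ))]
    · congr 1
      ext x
      simp only [Finset.mem_filter, Finset.mem_insert]
      by_cases hx : x = ((i + 1 : ℕ) : ℤ)
      · exact ⟨fun _ => Or.inl hx, fun _ => ⟨hx ▸ h, by push_cast at *; omega⟩⟩
      · constructor
        · rintro ⟨h1, h2⟩; right; exact ⟨h1, h2.1, by push_cast at *; omega⟩
        · rintro (h1 | ⟨h1, h2⟩)
          · exact absurd h1 hx
          · exact ⟨h1, h2.1, by push_cast at *; omega⟩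
    · simp
  · rw [add_zero]
    congr 1
    ext x
    simp only [Finset.mem_filter]
    by_cases hx : x = ((i + 1 : ℕ) : ℤ)
    · exact iff_of_false (fun hh => h (hx ▸ hh.1)) fun hh => h (hx ▸ hh.1)
    · refine and_congr_right fun _ => ?_
      push_cast at *
      omega

theorem negCount_mono (S : Finset ℤ) : Monotone (negCount S) :=
  monotone_nat_of_le_succ fun i => by rw [negCount_succ]; omega

theorem posCount_mono (S : Finset ℤ) : Monotone (posCount S) :=
  monotone_nat_of_le_succ fun i => by rw [posCount_succ]; omega

theorem negCount_le (S : Finset ℤ) (i : ℕ) : negCount S i ≤ i := by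
  induction i with
  | zero => rw [negCount_zero]
  | succ i ih => rw [negCount_succ]; split_ifs <;> omega

theorem posCount_le (S : Finset ℤ) (i : ℕ) : posCount S i ≤ i := by
  induction i with
  | zero => rw [posCount_zero]
  | succ i ih => rw [posCount_succ]; split_ifs <;> omega

section Catalan

variable {n : ℕ} {S : Finset ℤ}

theorem IsCentredCatalanSet.bounds (hS : IsCentredCatalanSet (n + 1) S) {x : ℤ} (hx : x ∈ S) :
    -(n : ℤ) ≤ x ∧ x ≤ n := by
  have := Finset.mem_Icc.1 (hS.2.1 hx)
  push_cast at this
  omega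

theorem IsCentredCatalanSet.zero_mem (hS : IsCentredCatalanSet (n + 1) S) : (0 : ℤ) ∈ S := by
  have h := hS.2.2 0 (by omega)
  by_contra h0
  have : S ∩ Finset.Icc (-((0 : ℕ) : ℤ)) ((0 : ℕ) : ℤ) = ∅ := by
    simp [h0]
  rw [this] at h
  simp at h

theorem card_inter_Icc (h0 : (0 : ℤ) ∈ S) (i : ℕ) :
    (S ∩ Finset.Icc (-(i : ℤ)) (i : ℤ)).card = negCount S i + posCount S i + 1 := by
  have e : S ∩ Finset.Icc (-(i : ℤ)) (i : ℤ) =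
      insert 0 ((S.filter fun x => -(i : ℤ) ≤ x ∧ x < 0) ∪
        (S.filter fun x => 0 < x ∧ x ≤ (i : ℤ))) := by
    ext x
    simp only [Finset.mem_inter, Finset.mem_Icc, Finset.mem_insert, Finset.mem_union,
      Finset.mem_filter]
    by_cases hx : x = 0
    · subst hx; simp [h0]
    · by_cases hxS : x ∈ S <;> simp only [hxS, hx, true_and, false_and, or_false, false_or] ; omega
  rw [e, Finset.card_insert_of_notMem (by simp), Finset.card_union_of_disjoint]
  · rfl
  · rw [Finset.disjoint_filter]
    intro x _
    omega

/-- The Catalan condition says that the Motzkin path stays weakly above the axis. It makes the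
truncated differences `negCount S i + posCount S i - i` genuine heights. -/
theorem IsCentredCatalanSet.le_count (hS : IsCentredCatalanSet (n + 1) S) {i : ℕ} (hi : i ≤ n) :
    i ≤ negCount S i + posCount S i := by
  have := hS.2.2 i (by omega)
  rw [card_inter_Icc hS.zero_mem] at this
  omega

theorem IsCentredCatalanSet.count_eq (hS : IsCentredCatalanSet (n + 1) S) :
    negCount S n + posCount S n = n := by
  have h := card_inter_Icc hS.zero_mem n
  rw [Finset.inter_eq_left.2, hS.1] at h
  · omega
  · intro x hx
    have := hS.bounds hx
    simp only [Finset.mem_Icc]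
    omega

theorem IsCentredCatalanSet.negCount_of_le (hS : IsCentredCatalanSet (n + 1) S) {i : ℕ}
    (hi : n ≤ i) : negCount S i = (negPart S).card := by
  rw [negCount, negPart]
  congr 1
  refine Finset.filter_congr fun x hx => ?_
  have := hS.bounds hx
  omega

theorem IsCentredCatalanSet.posCount_of_le (hS : IsCentredCatalanSet (n + 1) S) {i : ℕ}
    (hi : n ≤ i) : posCount S i = (posPart S).card := by
  rw [posCount, posPart]
  congr 1
  refine Finset.filter_congr fun x hx => ?_
  have := hS.bounds hx
  omega

theorem length_augment (S : Finset ℤ) (l i : ℕ) (t : List ℤ) :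
    (augment S l (i + 1) t).length + negCount S i + posCount S i =
      t.length + negCount S (i + 1) + posCount S (i + 1) := by
  rw [negCount_succ, posCount_succ, augment]
  by_cases h1 : -((i + 1 : ℕ) : ℤ) ∈ S <;> by_cases h2 : ((i + 1 : ℕ) : ℤ) ∈ S <;>
    simp only [h1, h2, if_true, if_false, List.length_append, List.length_nil,
      List.length_cons] <;> omega

/-- An interlacing step loses one entry and augmentation gains one for each of `-i`, `i` in `S`, so
the length changes by the Motzkin step. -/
theorem IsMonotoneChain.length {l : ℕ} {t : ℕ → List ℤ} (h : IsMonotoneChain S n l t) {i : ℕ}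
    (hi : i ≤ n) : (t i).length + i = negCount S i + posCount S i := by
  induction i with
  | zero => simp [h.1, negCount_zero, posCount_zero]
  | succ i ih =>
    have h1 := ih (by omega)
    have h2 := (h.2.1 i (by omega)).1.1
    have h3 := length_augment S l i (t i)
    omega

/-- The path returns to height 0, so the end condition need not be part of the definition of a
chain. -/
theorem IsMonotoneChain.last (hS : IsCentredCatalanSet (n + 1) S) {l : ℕ} {t : ℕ → List ℤ}
    (h : IsMonotoneChain S n l t) : t n = [] := by
  have := h.length le_rfl
  have := hS.count_eq
  rw [← List.length_eq_zero_iff]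
  omega

/-! ### Trapezoids and chains -/

/-- `j` is the label of a column which corresponds to an element of `S`. -/
def IsCol (S : Finset ℤ) (l : ℕ) (j : ℤ) : Prop :=
  (j ≤ 0 ∧ j - 1 ∈ S) ∨ ((l : ℤ) ≤ j ∧ j - ((l : ℤ) - 1) ∈ S)

open Classical in
/-- The array associated with a chain. -/
noncomputable def arrayOf (S : Finset ℤ) (n l : ℕ) (t : ℕ → List ℤ) (i : ℕ) (j : ℤ) : ℤ :=
  if 1 ≤ i ∧ i ≤ n then ind (augment S l i (t (i - 1))) j - ind (t i) j else 0

-- Going from row `i` to row `i + 1`, exactly the columns `-i` and `l + i` pass from outside the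
-- span to inside it. Those that come from `S` leave the indicator of outer columns and enter the
-- list. This identity makes the upper column sums telescope.
open Classical in
theorem ind_augment {l i : ℕ} (hl : 1 ≤ l) {t : List ℤ} (ht : IsAdmissible l i t) (j : ℤ) :
    ind (augment S l (i + 1) t) j + (if IsCol S l j ∧ (j < -((i + 1 : ℕ) : ℤ) + 1 ∨
        (l : ℤ) + (i + 1 : ℕ) - 1 < j) then 1 else 0) =
      ind t j + if IsCol S l j ∧ (j < -(i : ℤ) + 1 ∨ (l : ℤ) + i - 1 < j) then 1 else 0 := by
  have h0 : j ∈ t → -(i : ℤ) + 1 ≤ j ∧ j ≤ (l : ℤ) + i - 1 := ht.2 j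
  simp only [ind, mem_augment, IsCol]
  push_cast
  by_cases hj1 : j = -(i : ℤ)
  · have h1 : j ∉ t := fun h => by have := h0 h; omega
    have e : j - 1 = -(i + 1 : ℤ) := by omega
    have h2 : ¬ ((l : ℤ) ≤ j) := by omega
    have h3 : j ≤ 0 := by omega
    have h4 : (j = -(i + 1 : ℤ) + 1) = True := eq_true (by omega)
    have h5 : ¬ (j = (l : ℤ) + (i + 1) - 1) := by omega
    have h6 : j < -(i : ℤ) + 1 := by omega
    have h7 : ¬ j < -(i + 1 : ℤ) + 1 := by omega
    have h8 : ¬ ((l : ℤ) + (i + 1) - 1 < j) := by omega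
    simp only [h1, h2, h3, h4, h5, h6, h7, h8, e, false_or, true_and, false_and, or_false,
      and_false, if_false, add_zero, zero_add, true_or, and_true]
  · by_cases hj2 : j = (l : ℤ) + i
    · have h1 : j ∉ t := fun h => by have := h0 h; omega
      have e : j - ((l : ℤ) - 1) = (i + 1 : ℤ) := by omega
      have h2 : (l : ℤ) ≤ j := by omega
      have h3 : ¬ j ≤ 0 := by omega
      have h4 : ¬ (j = -(i + 1 : ℤ) + 1) := by omega
      have h5 : (j = (l : ℤ) + (i + 1) - 1) = True := eq_true (by omega)
      have h6 : (l : ℤ) + i - 1 < j := by omega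
      have h7 : ¬ j < -(i + 1 : ℤ) + 1 := by omega
      have h8 : ¬ ((l : ℤ) + (i + 1) - 1 < j) := by omega
      simp only [h1, h2, h3, h4, h5, h6, h7, h8, e, false_or, true_and, false_and, or_true,
        and_false, if_false, add_zero, zero_add, and_true]
    · have h4 : ¬ (j = -(i + 1 : ℤ) + 1) := by omega
      have h5 : ¬ (j = (l : ℤ) + (i + 1) - 1) := by omega
      have h6 : (j < -(i + 1 : ℤ) + 1 ∨ (l : ℤ) + (i + 1) - 1 < j) ↔
          (j < -(i : ℤ) + 1 ∨ (l : ℤ) + i - 1 < j) := by omega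
      simp only [h4, h5, h6, false_and, or_false]
      congr

-- Downward induction from the top row: inside the span of row `i` the upper sum is read off from `t
-- i`, outside it is the full column sum prescribed by `S`.
open Classical in
theorem suffix_sum_arrayOf (hS : IsCentredCatalanSet (n + 1) S) {l : ℕ} (hl : 1 ≤ l)
    {t : ℕ → List ℤ} (h : IsMonotoneChain S n l t) {i : ℕ} (hi : i ≤ n) (j : ℤ) :
    ∑ x ∈ Finset.Ioc i n, arrayOf S n l t x j =
      ind (t i) j + if IsCol S l j ∧ (j < -(i : ℤ) + 1 ∨ (l : ℤ) + i - 1 < j) then 1 else 0 := by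
  induction hi using Nat.decreasingInduction with
  | self =>
    have : ¬ (IsCol S l j ∧ (j < -(n : ℤ) + 1 ∨ (l : ℤ) + n - 1 < j)) := by
      rintro ⟨⟨h1, h2⟩ | ⟨h1, h2⟩, h3⟩ <;> have := hS.bounds h2 <;> omega
    rw [if_neg this]
    simp [h.last hS, ind]
  | of_succ i hi ih =>
    rw [sum_Ioc_eq_add _ hi, ih, arrayOf, if_pos ⟨by omega, by omega⟩, Nat.add_sub_cancel,
      ← ind_augment hl (h.isAdmissible hl i)]
    ring

theorem sum_Icc_one_eq (f : ℕ → ℤ) : ∑ x ∈ Finset.Icc 1 n, f x = ∑ x ∈ Finset.Ioc 0 n, f x := by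
  congr 1

-- Relabelling is a bijection from the non-central columns onto the non-zero integers, so once
-- column sums are 0 or 1 the associated set carries the same information as all of them.
open Classical in
theorem associatedSet_eq_iff (hS : IsCentredCatalanSet (n + 1) S) {l : ℕ} (hl : 1 ≤ l)
    {A : ℕ → ℤ → ℤ} (hsupp : ∀ j, ∑ i ∈ Finset.Icc 1 n, A i j ≠ 0 →
      -(n : ℤ) + 1 ≤ j ∧ j ≤ (l : ℤ) + n - 1)
    (hc : ∀ j : ℤ, 1 ≤ j → j ≤ (l : ℤ) - 1 → ∑ i ∈ Finset.Icc 1 n, A i j = 0)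
    (h01 : ∀ j, ∑ i ∈ Finset.Icc 1 n, A i j = 0 ∨ ∑ i ∈ Finset.Icc 1 n, A i j = 1) :
    associatedSet n l A = S ↔
      ∀ j, ∑ i ∈ Finset.Icc 1 n, A i j = if IsCol S l j then 1 else 0 := by
  have mem : ∀ s, s ∈ associatedSet n l A ↔
      s = 0 ∨ ∃ j, 0 < ∑ i ∈ Finset.Icc 1 n, A i j ∧ shiftLabel l j = s := by
    intro s
    simp only [associatedSet, Finset.mem_insert, Finset.mem_image, Finset.mem_filter,
      Finset.mem_Icc]
    refine or_congr_right (exists_congr fun j => and_congr_left fun _ => ?_)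
    exact ⟨fun h => h.2, fun h => ⟨hsupp j (by omega), h⟩⟩
  constructor
  · intro h j
    have key : 0 < ∑ i ∈ Finset.Icc 1 n, A i j ↔ IsCol S l j := by
      constructor
      · intro hj
        have h1 : shiftLabel l j ∈ S := by rw [← h, mem]; exact Or.inr ⟨j, hj, rfl⟩
        have h2 := hc j
        rw [shiftLabel] at h1
        split_ifs at h1 with h3
        · exact Or.inl ⟨h3, h1⟩
        · exact Or.inr ⟨by omega, h1⟩
      · rintro (⟨h1, h2⟩ | ⟨h1, h2⟩)
        · rw [← h, mem] at h2
          rcases h2 with h2 | ⟨j', h2, h3⟩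
          · omega
          · have h4 := hc j'
            rw [shiftLabel] at h3
            have : j' = j := by split_ifs at h3 <;> omega
            exact this ▸ h2
        · rw [← h, mem] at h2
          rcases h2 with h2 | ⟨j', h2, h3⟩
          · omega
          · rw [shiftLabel] at h3
            have : j' = j := by split_ifs at h3 <;> omega
            exact this ▸ h2
    have := h01 j
    split_ifs with hj
    · have := key.2 hj; omega
    · have : ¬ 0 < ∑ i ∈ Finset.Icc 1 n, A i j := fun h => hj (key.1 h)
      omega
  · intro h
    have pos : ∀ j, 0 < ∑ i ∈ Finset.Icc 1 n, A i j ↔ IsCol S l j := by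
      intro j
      rw [h j]
      split_ifs with hj <;> simp [hj]
    ext s
    rw [mem]
    constructor
    · rintro (rfl | ⟨j, hj, rfl⟩)
      · exact hS.zero_mem
      · rw [pos] at hj
        rw [shiftLabel]
        rcases hj with ⟨h1, h2⟩ | ⟨h1, h2⟩
        · rwa [if_pos h1]
        · rwa [if_neg (by omega)]
    · intro hs
      rcases lt_trichotomy s 0 with h1 | h1 | h1
      · refine Or.inr ⟨s + 1, (pos _).2 (Or.inl ⟨by omega, by simpa using hs⟩), ?_⟩
        rw [shiftLabel, if_pos (by omega)]; ring
      · exact Or.inl h1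
      · refine Or.inr ⟨s + ((l : ℤ) - 1), (pos _).2 (Or.inr ⟨by omega, by simpa using hs⟩), ?_⟩
        rw [shiftLabel, if_neg (by omega)]; ring

/-- By `interlaces_iff_countLE`, this difference of counting functions is always 0 or 1 exactly when
the lists interlace, given the right lengths; this is the link between interlacing and row
alternation. -/
theorem sum_row_arrayOf {l : ℕ} (hl : 1 ≤ l) {t : ℕ → List ℤ} (h : IsMonotoneChain S n l t)
    {i : ℕ} (hi : i < n) (j : ℤ) :
    ∑ x ∈ Finset.Icc (-((i + 1 : ℕ) : ℤ) + 1) j, arrayOf S n l t (i + 1) x =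
      countLE (augment S l (i + 1) (t i)) j - countLE (t (i + 1)) j := by
  have h1 := isAdmissible_augment (S := S) hl (h.isAdmissible hl i)
  have h2 := h.isAdmissible hl (i + 1)
  have e : ∀ x, arrayOf S n l t (i + 1) x =
      ind (augment S l (i + 1) (t i)) x - ind (t (i + 1)) x := fun x => by
    rw [arrayOf, if_pos ⟨by omega, by omega⟩, Nat.add_sub_cancel]
  simp only [e]
  rw [Finset.sum_sub_distrib, sum_ind_Icc h1.1 fun x hx => (h1.2 x hx).1,
    sum_ind_Icc h2.1 fun x hx => (h2.2 x hx).1]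

theorem arrayOf_support {l : ℕ} (hl : 1 ≤ l) {t : ℕ → List ℤ} (h : IsMonotoneChain S n l t)
    (i : ℕ) (j : ℤ) (hA : arrayOf S n l t i j ≠ 0) :
    (1 ≤ i ∧ i ≤ n) ∧ (-(i : ℤ) + 1 ≤ j ∧ j ≤ (l : ℤ) + (i : ℤ) - 1) := by
  rw [arrayOf] at hA
  split_ifs at hA with hi
  · refine ⟨hi, ?_⟩
    obtain ⟨i, rfl⟩ : ∃ k, i = k + 1 := ⟨i - 1, by omega⟩
    have h1 := (isAdmissible_augment (S := S) hl (h.isAdmissible hl i)).2 j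
    have h2 := (h.isAdmissible hl (i + 1)).2 j
    simp only [ind, Nat.add_sub_cancel] at hA
    by_cases m1 : j ∈ augment S l (i + 1) (t i)
    · exact h1 m1
    · by_cases m2 : j ∈ t (i + 1)
      · exact h2 m2
      · simp [m1, m2] at hA
  · exact absurd rfl hA

theorem isASTrapezoid_arrayOf (hS : IsCentredCatalanSet (n + 1) S) {l : ℕ} (hl : 1 ≤ l)
    {t : ℕ → List ℤ} (h : IsMonotoneChain S n l t) :
    IsASTrapezoid n l (arrayOf S n l t) ∧ associatedSet n l (arrayOf S n l t) = S := by
  classical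
  have supp := arrayOf_support hl h
  have hcol : ∀ i j, ∑ x ∈ Finset.Ioc i n, arrayOf S n l t x j = 0 ∨
      ∑ x ∈ Finset.Ioc i n, arrayOf S n l t x j = 1 := by
    intro i j
    rcases le_or_gt i n with hi | hi
    · rw [suffix_sum_arrayOf hS hl h hi j]
      have h1 := (h.isAdmissible hl i).2 j
      simp only [ind]
      split_ifs with h2 h3 <;> simp
      have := h1 h2
      omega
    · left; rw [Finset.Ioc_eq_empty (by omega), Finset.sum_empty]
  have htot : ∀ j, ∑ i ∈ Finset.Icc 1 n, arrayOf S n l t i j =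
      if IsCol S l j then 1 else 0 := by
    intro j
    rw [sum_Icc_one_eq, suffix_sum_arrayOf hS hl h (Nat.zero_le n) j, h.1]
    have : IsCol S l j ∧ (j < -((0 : ℕ) : ℤ) + 1 ∨ (l : ℤ) + (0 : ℕ) - 1 < j) ↔ IsCol S l j := by
      refine and_iff_left_of_imp fun hj => ?_
      rcases hj with ⟨h1, -⟩ | ⟨h1, -⟩ <;> push_cast <;> omega
    simp only [this, ind, List.not_mem_nil, if_false, zero_add]
  have hcentral : ∀ j : ℤ, 1 ≤ j → j ≤ (l : ℤ) - 1 →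
      ∑ i ∈ Finset.Icc 1 n, arrayOf S n l t i j = 0 := by
    intro j h1 h2
    rw [htot, if_neg]
    rintro (⟨h3, -⟩ | ⟨h3, -⟩) <;> omega
  have hrow : ∀ i, i < n → ∀ j,
      ∑ x ∈ Finset.Icc (-((i + 1 : ℕ) : ℤ) + 1) j, arrayOf S n l t (i + 1) x = 0 ∨
      ∑ x ∈ Finset.Icc (-((i + 1 : ℕ) : ℤ) + 1) j, arrayOf S n l t (i + 1) x = 1 := by
    intro i hi j
    rw [sum_row_arrayOf hl h hi]
    have h1 := (isAdmissible_augment (S := S) hl (h.isAdmissible hl i)).1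
    have h2 := ((interlaces_iff_countLE h1 (h.2.1 i hi).2).1 (h.2.1 i hi).1).2 j
    omega
  refine ⟨⟨supp, ?_, ?_, hcentral, ?_, ?_, ?_⟩, ?_⟩
  · intro i j
    rw [arrayOf]
    have := ind_mem (augment S l i (t (i - 1))) j
    have := ind_mem (t i) j
    split_ifs <;> omega
  · intro i h1 h2
    obtain ⟨i, rfl⟩ : ∃ k, i = k + 1 := ⟨i - 1, by omega⟩
    rw [sum_row_arrayOf hl h (by omega), countLE_eq_length, countLE_eq_length]
    · have := (h.2.1 i (by omega)).1.1
      omega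
    · exact fun x hx => ((h.isAdmissible hl (i + 1)).2 x hx).2
    · exact fun x hx => ((isAdmissible_augment (S := S) hl (h.isAdmissible hl i)).2 x hx).2
  · intro i j j' hjj hj hj' h0
    have hi := (supp i j hj).1
    obtain ⟨i, rfl⟩ : ∃ k, i = k + 1 := ⟨i - 1, by omega⟩
    refine alternating_of_prefix_sum (a := -((i + 1 : ℕ) : ℤ) + 1) (fun x hx => ?_)
      (hrow i (by omega)) j j' hjj hj hj' h0
    by_contra hne
    have := (supp _ _ hne).2
    omega
  · intro i i' j
    exact alternating_of_suffix_sum (fun x hx => (supp x j hx).1) (fun x => hcol x j) i i'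
  · intro i j
    exact top_positive_of_suffix_sum (fun x hx => (supp x j hx).1) (fun x => hcol x j) i
  · refine (associatedSet_eq_iff hS hl (fun j hj => ?_) hcentral (fun j => ?_)).2 htot
    · obtain ⟨i, -, hi⟩ := Finset.exists_ne_zero_of_sum_ne_zero hj
      have := supp i j hi
      omega
    · rw [sum_Icc_one_eq]; exact hcol 0 j

/-- Each row, together with the previous member of the chain, determines the next member. -/
theorem arrayOf_injective {l : ℕ} {t t' : ℕ → List ℤ} (h : IsMonotoneChain S n l t)
    (h' : IsMonotoneChain S n l t') (heq : arrayOf S n l t = arrayOf S n l t') : t = t' := by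
  funext i
  induction i with
  | zero => rw [h.1, h'.1]
  | succ i ih =>
    rcases lt_or_ge i n with hi | hi
    · refine eq_of_ind_eq (h.2.1 i hi).2 (h'.2.1 i hi).2 fun j => ?_
      have := congrFun (congrFun heq (i + 1)) j
      simp only [arrayOf, Nat.add_sub_cancel, ih] at this
      rw [if_pos ⟨by omega, by omega⟩, if_pos ⟨by omega, by omega⟩] at this
      omega
    · rw [h.2.2 _ (by omega), h'.2.2 _ (by omega)]

/-- The chain of an array. -/
noncomputable def chainOf (n l : ℕ) (A : ℕ → ℤ → ℤ) (i : ℕ) : List ℤ :=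
  if i ≤ n then ((Finset.Icc (-(i : ℤ) + 1) ((l : ℤ) + i - 1)).filter
    (fun j => ∑ x ∈ Finset.Ioc i n, A x j = 1)).sort (· ≤ ·) else []

theorem mem_chainOf {l : ℕ} {A : ℕ → ℤ → ℤ} {i : ℕ} (hi : i ≤ n) {j : ℤ} :
    j ∈ chainOf n l A i ↔ (-(i : ℤ) + 1 ≤ j ∧ j ≤ (l : ℤ) + i - 1) ∧
      ∑ x ∈ Finset.Ioc i n, A x j = 1 := by
  simp [chainOf, hi]

theorem isAdmissible_chainOf {l : ℕ} {A : ℕ → ℤ → ℤ} {i : ℕ} (hi : i ≤ n) :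
    IsAdmissible l i (chainOf n l A i) := by
  refine ⟨?_, fun x hx => ((mem_chainOf hi).1 hx).1⟩
  rw [chainOf, if_pos hi]
  exact (Finset.sortedLT_sort _).pairwise

/-- Surjectivity of `arrayOf`: the upper column sums recover the chain, and the prefix sums of each
row give interlacing. -/
theorem chainOf_spec (hS : IsCentredCatalanSet (n + 1) S) {l : ℕ} (hl : 1 ≤ l)
    {A : ℕ → ℤ → ℤ} (hA : IsASTrapezoid n l A) (hAS : associatedSet n l A = S) :
    IsMonotoneChain S n l (chainOf n l A) ∧ arrayOf S n l (chainOf n l A) = A := by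
  classical
  have hcol : ∀ i j, ∑ x ∈ Finset.Ioc i n, A x j = 0 ∨ ∑ x ∈ Finset.Ioc i n, A x j = 1 := by
    intro i j
    refine suffix_sum_of_alternating (fun i => hA.entries i j)
      (fun i i' => hA.col_alternating i i' j) (fun i => hA.top_positive i j) (fun i hi => ?_) i
    by_contra hne
    have := (hA.support i j hne).1
    omega
  have htot : ∀ j, ∑ i ∈ Finset.Icc 1 n, A i j = if IsCol S l j then 1 else 0 := by
    refine (associatedSet_eq_iff hS hl (fun j hj => ?_) hA.central_col_sum (fun j => ?_)).1 hAS
    · obtain ⟨i, -, hi⟩ := Finset.exists_ne_zero_of_sum_ne_zero hj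
      have := hA.support i j hi
      omega
    · rw [sum_Icc_one_eq]; exact hcol 0 j
  have hsuf : ∀ i ≤ n, ∀ j, ∑ x ∈ Finset.Ioc i n, A x j = ind (chainOf n l A i) j +
      if IsCol S l j ∧ (j < -(i : ℤ) + 1 ∨ (l : ℤ) + i - 1 < j) then 1 else 0 := by
    intro i hi j
    by_cases hj : -(i : ℤ) + 1 ≤ j ∧ j ≤ (l : ℤ) + i - 1
    · rw [if_neg (by omega), add_zero, ind]
      simp only [mem_chainOf hi, hj, true_and, and_self]
      have := hcol i j
      split_ifs <;> omega
    · have h1 : (j < -(i : ℤ) + 1 ∨ (l : ℤ) + i - 1 < j) := by omega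
      simp only [ind, mem_chainOf hi, hj, false_and, if_false, zero_add, h1, and_true]
      rw [← htot, sum_Icc_one_eq, sum_Ioc_split (fun x => A x j) (Nat.zero_le i) hi,
        right_eq_add]
      refine Finset.sum_eq_zero fun x hx => ?_
      by_contra hne
      have := hA.support x j hne
      have := (Finset.mem_Ioc.1 hx).2
      omega
  have harr : ∀ i < n, ∀ j, A (i + 1) j = ind (augment S l (i + 1) (chainOf n l A i)) j -
      ind (chainOf n l A (i + 1)) j := by
    intro i hi j
    have h1 := sum_Ioc_eq_add (fun x => A x j) hi
    rw [hsuf i hi.le, hsuf (i + 1) hi] at h1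
    have h2 := ind_augment (S := S) hl (isAdmissible_chainOf (A := A) hi.le) j
    linarith
  refine ⟨⟨?_, fun i hi => ?_, fun i hi => if_neg (by omega)⟩, ?_⟩
  -- For `i = 0` the span is `1, …, l - 1`, the central columns, whose sums vanish.
  · rw [List.eq_nil_iff_forall_not_mem]
    intro j hj
    rw [mem_chainOf (Nat.zero_le n)] at hj
    obtain ⟨⟨h1, h2⟩, h3⟩ := hj
    push_cast at h1 h2
    have := hA.central_col_sum j (by omega) (by omega)
    rw [sum_Icc_one_eq] at this
    omega
  · have h1 := isAdmissible_augment (S := S) hl (isAdmissible_chainOf (l := l) (A := A) hi.le)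
    have h2 := isAdmissible_chainOf (l := l) (A := A) (show i + 1 ≤ n by omega)
    have hrow : ∀ j, ∑ x ∈ Finset.Icc (-((i + 1 : ℕ) : ℤ) + 1) j, A (i + 1) x =
        countLE (augment S l (i + 1) (chainOf n l A i)) j -
          countLE (chainOf n l A (i + 1)) j := by
      intro j
      simp only [harr i hi]
      rw [Finset.sum_sub_distrib, sum_ind_Icc h1.1 fun x hx => (h1.2 x hx).1,
        sum_ind_Icc h2.1 fun x hx => (h2.2 x hx).1]
    have hs := hA.row_sum (i + 1) (by omega) (by omega)
    refine ⟨(interlaces_iff_countLE h1.1 h2.1).2 ⟨?_, fun j => ?_⟩, h2.1⟩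
    · rw [hrow, countLE_eq_length fun x hx => (h1.2 x hx).2,
        countLE_eq_length fun x hx => (h2.2 x hx).2] at hs
      omega
    · have := prefix_sum_of_alternating (fun j => hA.entries (i + 1) j)
        (fun j j' => hA.row_alternating (i + 1) j j') (fun j hj => by
          by_contra hne
          have := (hA.support _ _ hne).2
          omega) hs j
      rw [hrow] at this
      omega
  · funext i j
    rw [arrayOf]
    split_ifs with hi
    · obtain ⟨i, rfl⟩ : ∃ k, i = k + 1 := ⟨i - 1, by omega⟩
      rw [harr i (by omega), Nat.add_sub_cancel]
    · by_contra hne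
      exact hi (hA.support i j (Ne.symm hne)).1

/-- The weight of `S` counts chains of interlacing lists. -/
theorem weight_eq_ncard_chains (hS : IsCentredCatalanSet (n + 1) S) {l : ℕ} (hl : 1 ≤ l) :
    weight l S = {t | IsMonotoneChain S n l t}.ncard := by
  rw [weight, hS.1, Nat.add_sub_cancel]
  symm
  refine Set.ncard_congr (fun t _ => arrayOf S n l t)
    (fun t ht => isASTrapezoid_arrayOf hS hl ht) (fun t t' ht ht' h => arrayOf_injective ht ht' h)
    fun A hA => ⟨chainOf n l A, (chainOf_spec hS hl hA.1 hA.2).1, (chainOf_spec hS hl hA.1 hA.2).2⟩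

theorem finite_setOf_isMonotoneChain (hS : IsCentredCatalanSet (n + 1) S) {l : ℕ} (hl : 1 ≤ l) :
    {t | IsMonotoneChain S n l t}.Finite :=
  Set.Finite.of_injOn (f := arrayOf S n l) (fun _ ht => (isASTrapezoid_arrayOf hS hl ht).1)
    (fun _ ht _ ht' h => arrayOf_injective ht ht' h) (finite_setOf_isASTrapezoid n l)

end Catalan

/-! ### Counting chains recursively -/

/-- The strictly increasing lists that interlace a given list. -/
noncomputable def interlacing : List ℤ → Finset (List ℤ)
  | [] => ∅
  | u :: us => fill u us

theorem mem_interlacing {u : List ℤ} (hu : u.Pairwise (· < ·)) {t : List ℤ} :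
    t ∈ interlacing u ↔ Interlaces u t ∧ t.Pairwise (· < ·) := by
  cases u with
  | nil => simp [interlacing, Interlaces]
  | cons a u =>
    rw [List.pairwise_cons] at hu
    exact mem_fill hu.2 (fun v hv => (hu.1 v hv).le) t

open Classical in
/-- The chains of `m` steps which start with `t₀` as their `i`-th member. -/
noncomputable def chainsFrom (S : Finset ℤ) (l : ℕ) : ℕ → ℕ → List ℤ → Finset (ℕ → List ℤ)
  | 0, i, t₀ => {Function.update (fun _ => []) i t₀}
  | m + 1, i, t₀ => (interlacing (augment S l (i + 1) t₀)).biUnion fun t' =>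
      (chainsFrom S l m (i + 1) t').image fun t => Function.update t i t₀

theorem mem_chainsFrom {S : Finset ℤ} {l : ℕ} (hl : 1 ≤ l) (m i : ℕ) {t₀ : List ℤ}
    (h : IsAdmissible l i t₀) (t : ℕ → List ℤ) :
    t ∈ chainsFrom S l m i t₀ ↔ t i = t₀ ∧
      (∀ j, i ≤ j → j < i + m → IsStep S l (j + 1) (t j) (t (j + 1))) ∧
      ∀ j, j < i ∨ i + m < j → t j = [] := by
  induction m generalizing i t₀ t with
  | zero =>
    rw [chainsFrom, Finset.mem_singleton]
    constructor
    · rintro rfl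
      refine ⟨by simp, fun j h1 h2 => by omega, fun j hj => ?_⟩
      rw [Function.update_of_ne (by omega)]
    · rintro ⟨h1, -, h2⟩
      funext j
      by_cases hj : j = i
      · subst hj; simp [h1]
      · rw [Function.update_of_ne hj, h2 j (by omega)]
  | succ m ih =>
    have hadm := isAdmissible_augment (S := S) hl h
    simp only [chainsFrom, Finset.mem_biUnion, Finset.mem_image]
    constructor
    · rintro ⟨t', ht', s, hs, rfl⟩
      have hstep : IsStep S l (i + 1) t₀ t' := (mem_interlacing hadm.1).1 ht'
      obtain ⟨h1, h2, h3⟩ := (ih (i + 1) (isAdmissible_of_isStep hl h hstep) s).1 hs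
      refine ⟨by simp, fun j hj hj' => ?_, fun j hj => ?_⟩
      · rw [Function.update_of_ne (show j + 1 ≠ i by omega)]
        by_cases hji : j = i
        · subst hji
          rw [Function.update_self, h1]
          exact hstep
        · rw [Function.update_of_ne hji]
          exact h2 j (by omega) (by omega)
      · rw [Function.update_of_ne (by omega)]
        exact h3 j (by omega)
    · rintro ⟨h1, h2, h3⟩
      have hstep := h2 i le_rfl (by omega)
      rw [h1] at hstep
      -- Chains are empty outside their index range, so the tail is obtained by erasing the `i`-th
      -- member.
      refine ⟨t (i + 1), (mem_interlacing hadm.1).2 hstep, Function.update t i [], ?_, ?_⟩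
      · rw [ih (i + 1) (isAdmissible_of_isStep hl h hstep)]
        refine ⟨by rw [Function.update_of_ne (by omega)], fun j hj hj' => ?_, fun j hj => ?_⟩
        · rw [Function.update_of_ne (show j ≠ i by omega),
            Function.update_of_ne (show j + 1 ≠ i by omega)]
          exact h2 j (by omega) (by omega)
        · by_cases hji : j = i
          · subst hji; simp
          · rw [Function.update_of_ne hji]
            exact h3 j (by omega)
      · rw [Function.update_idem, ← h1, Function.update_eq_self]

theorem card_chainsFrom_succ {S : Finset ℤ} {l : ℕ} (hl : 1 ≤ l) (m i : ℕ) {t₀ : List ℤ}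
    (h : IsAdmissible l i t₀) : (chainsFrom S l (m + 1) i t₀).card =
      ∑ t' ∈ interlacing (augment S l (i + 1) t₀), (chainsFrom S l m (i + 1) t').card := by
  classical
  have hadm : ∀ t' ∈ interlacing (augment S l (i + 1) t₀), IsAdmissible l (i + 1) t' :=
    fun t' ht' => isAdmissible_of_isStep hl h
      ((mem_interlacing (isAdmissible_augment (S := S) hl h).1).1 ht')
  rw [chainsFrom, Finset.card_biUnion]
  · refine Finset.sum_congr rfl fun t' ht' => Finset.card_image_of_injOn ?_
    intro s hs s' hs' hss
    have h1 := (mem_chainsFrom hl m (i + 1) (hadm t' ht') s).1 hs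
    have h2 := (mem_chainsFrom hl m (i + 1) (hadm t' ht') s').1 hs'
    funext j
    by_cases hj : j = i
    · rw [h1.2.2 j (by omega), h2.2.2 j (by omega)]
    · have := congrFun hss j
      simpa only [Function.update_of_ne hj] using this
  · intro t' ht' t'' ht'' hne
    rw [Function.onFun, Finset.disjoint_left]
    intro s hs hs'
    obtain ⟨r, hr, rfl⟩ := Finset.mem_image.1 hs
    obtain ⟨r', hr', hrr⟩ := Finset.mem_image.1 hs'
    have h1 := ((mem_chainsFrom hl m (i + 1) (hadm t' ht') r).1 hr).1
    have h2 := ((mem_chainsFrom hl m (i + 1) (hadm t'' ht'') r').1 hr').1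
    have := congrFun hrr (i + 1)
    rw [Function.update_of_ne (by omega), Function.update_of_ne (by omega), h1, h2] at this
    exact hne this.symm

theorem ncard_chains {S : Finset ℤ} {n l : ℕ} (hl : 1 ≤ l) :
    {t | IsMonotoneChain S n l t}.ncard = (chainsFrom S l n 0 []).card := by
  rw [← Set.ncard_coe_finset]
  congr 1
  ext t
  rw [Finset.mem_coe, mem_chainsFrom hl n 0 (isAdmissible_nil l 0)]
  simp [IsMonotoneChain]

/-! ### Polynomiality of iterated sums -/

open Polynomial in
/-- Sums of powers over integer intervals are values of polynomials. -/
theorem exists_polynomial_sum_Ico_pow (p : ℕ) : ∃ Q : ℚ[X], ∀ a b : ℤ, a ≤ b →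
    ∑ x ∈ Finset.Ico a b, (x : ℚ) ^ p = Q.eval (b : ℚ) - Q.eval (a : ℚ) := by
  refine ⟨C (1 / ((p : ℚ) + 1)) * Polynomial.bernoulli (p + 1), fun a b hab => ?_⟩
  induction b, hab using Int.leInduction with
  | base => simp
  | succ b hab ih =>
    have : Finset.Ico a (b + 1) = insert b (Finset.Ico a b) := by
      ext x; simp only [Finset.mem_insert, Finset.mem_Ico]; omega
    rw [this, Finset.sum_insert (by simp), ih]
    have h := Polynomial.bernoulli_eval_one_add (p + 1) (b : ℚ)
    push_cast at h ⊢
    have hp : (p : ℚ) + 1 ≠ 0 := by positivity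
    simp only [eval_mul, eval_C]
    rw [add_comm (b : ℚ) 1, h]
    field_simp
    ring

theorem polynomial_comp_mem {X : Type*} (A : Subalgebra ℚ (X → ℚ)) (Q : Polynomial ℚ)
    {f : X → ℚ} (hf : f ∈ A) : (fun x => Q.eval (f x)) ∈ A := by
  induction Q using Polynomial.induction_on' with
  | add P Q hP hQ =>
    simp only [Polynomial.eval_add]
    exact A.add_mem hP hQ
  | monomial k a =>
    simp only [Polynomial.eval_monomial]
    exact A.smul_mem (A.pow_mem hf k) a

/-- The monomial with exponents `e 0, …, e (h - 1)` in the entries of a list. -/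
def listMonomial (h : ℕ) (e : ℕ → ℕ) (t : List ℤ) : ℚ :=
  ∏ k ∈ Finset.range h, (t.getD k 0 : ℚ) ^ e k

theorem listMonomial_cons (h : ℕ) (e : ℕ → ℕ) (x : ℤ) (t : List ℤ) :
    listMonomial (h + 1) e (x :: t) = (x : ℚ) ^ e 0 * listMonomial h (fun k => e (k + 1)) t := by
  simp [listMonomial, Finset.prod_range_succ', mul_comm]

/-- Follows the recursion of `fill`: the sum over the first entry is a difference of values of a
polynomial, and the remaining sums have the same shape with lower bound `v` or `v + 1`. This is why
`lo` is a general function and only `lo ≤ v` is required. Off `D` the intervals may be reversed and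
the formula may fail, hence `hD`. -/
theorem sum_fill_listMonomial_mem {X : Type*} (A : Subalgebra ℚ (X → ℚ)) (D : Set X)
    (hD : ∀ f g : X → ℚ, g ∈ A → Set.EqOn f g D → f ∈ A) (vs : List (X → ℤ)) (lo : X → ℤ)
    (hlo : (fun x => (lo x : ℚ)) ∈ A) (hvs : ∀ v ∈ vs, (fun x => (v x : ℚ)) ∈ A)
    (hlt : ∀ x ∈ D, (vs.map fun v => v x).Pairwise (· < ·))
    (hle : ∀ x ∈ D, ∀ v ∈ vs, lo x ≤ v x) (e : ℕ → ℕ) :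
    (fun x => ∑ t ∈ fill (lo x) (vs.map fun v => v x), listMonomial vs.length e t) ∈ A := by
  induction vs generalizing lo e with
  | nil =>
    simp only [fill, listMonomial, List.length_nil, List.map_nil, Finset.sum_singleton,
      Finset.range_zero, Finset.prod_empty]
    exact A.one_mem
  | cons v vs ih =>
    obtain ⟨Q, hQ⟩ := exists_polynomial_sum_Ico_pow (e 0)
    have hv : (fun x => (v x : ℚ)) ∈ A := hvs v (by simp)
    have hv1 : (fun x => ((v x + 1 : ℤ) : ℚ)) ∈ A := by
      push_cast
      exact A.add_mem hv A.one_mem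
    have hvs' : ∀ w ∈ vs, (fun x => (w x : ℚ)) ∈ A := fun w hw => hvs w (by simp [hw])
    have hlt' : ∀ x ∈ D, (∀ w ∈ vs, v x < w x) ∧ (vs.map fun v => v x).Pairwise (· < ·) := by
      intro x hx
      have := hlt x hx
      rw [List.map_cons, List.pairwise_cons] at this
      simpa using this
    have h1 := ih v hv hvs' (fun x hx => (hlt' x hx).2)
      (fun x hx w hw => ((hlt' x hx).1 w hw).le) (fun k => e (k + 1))
    have h2 := ih (fun x => v x + 1) hv1 hvs' (fun x hx => (hlt' x hx).2)
      (fun x hx w hw => (hlt' x hx).1 w hw) (fun k => e (k + 1))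
    refine hD _ _ (A.add_mem (A.mul_mem (A.sub_mem (polynomial_comp_mem A Q hv)
      (polynomial_comp_mem A Q hlo)) h1) (A.mul_mem (A.pow_mem hv (e 0)) h2)) fun x hx => ?_
    simp only [List.map_cons, List.length_cons, sum_fill_cons, listMonomial_cons,
      ← Finset.mul_sum, ← Finset.sum_mul]
    rw [hQ _ _ (hle x hx v (by simp))]
    rfl

/-- The polynomial functions in `l` and the first `h` entries of a list. -/
def polyFun (h : ℕ) : Subalgebra ℚ (ℕ × List ℤ → ℚ) :=
  Algebra.adjoin ℚ ({fun x => (x.1 : ℚ)} ∪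
    {f | ∃ k < h, f = fun x => (x.2.getD k 0 : ℚ)})

/-- The functions which agree on `D` with a polynomial function. -/
def polyFunOn (D : Set (ℕ × List ℤ)) (h : ℕ) : Subalgebra ℚ (ℕ × List ℤ → ℚ) where
  carrier := {f | ∃ g ∈ polyFun h, Set.EqOn f g D}
  mul_mem' := by
    rintro f f' ⟨g, hg, hfg⟩ ⟨g', hg', hfg'⟩
    exact ⟨g * g', Subalgebra.mul_mem _ hg hg', fun x hx => by
      simp [hfg hx, hfg' hx]⟩
  add_mem' := by
    rintro f f' ⟨g, hg, hfg⟩ ⟨g', hg', hfg'⟩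
    exact ⟨g + g', Subalgebra.add_mem _ hg hg', fun x hx => by
      simp [hfg hx, hfg' hx]⟩
  algebraMap_mem' r := ⟨algebraMap ℚ _ r, Subalgebra.algebraMap_mem _ r, fun x _ => rfl⟩

theorem polyFun_le_polyFunOn (D : Set (ℕ × List ℤ)) (h : ℕ) : polyFun h ≤ polyFunOn D h :=
  fun f hf => ⟨f, hf, fun _ _ => rfl⟩

theorem polyFun_le_span (h : ℕ) {f : ℕ × List ℤ → ℚ} (hf : f ∈ polyFun h) :
    f ∈ Submodule.span ℚ {g | ∃ (a : ℕ) (e : ℕ → ℕ),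
      g = fun x : ℕ × List ℤ => (x.1 : ℚ) ^ a * listMonomial h e x.2} := by
  rw [← Subalgebra.mem_toSubmodule, polyFun, Algebra.adjoin_eq_span] at hf
  refine Submodule.span_mono ?_ hf
  intro g hg
  induction hg using Submonoid.closure_induction with
  | mem g hg =>
    rcases hg with rfl | ⟨k, hk, rfl⟩
    · exact ⟨1, fun _ => 0, by simp [listMonomial]⟩
    · refine ⟨0, Pi.single k 1, ?_⟩
      funext x
      rw [listMonomial, Finset.prod_eq_single k]
      · simp
      · intro j _ hj; simp [hj]
      · intro hk'; simp [hk] at hk'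
  | one => exact ⟨0, fun _ => 0, by funext x; simp [listMonomial]⟩
  | mul f g _ _ hf hg =>
    obtain ⟨a, e, rfl⟩ := hf
    obtain ⟨b, e', rfl⟩ := hg
    refine ⟨a + b, fun k => e k + e' k, ?_⟩
    funext x
    simp only [Pi.mul_apply, listMonomial, pow_add, Finset.prod_mul_distrib]
    ring

/-- The pairs of a positive integer `l` and an admissible list of length `h`. -/
def admissiblePairs (i h : ℕ) : Set (ℕ × List ℤ) :=
  {x | 1 ≤ x.1 ∧ IsAdmissible x.1 i x.2 ∧ x.2.length = h}

/-- By linearity monomials suffice. The entries of the augmented list are constants, coordinates and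
`l` plus a constant, so the iterated sum applies. The hypothesis `hh` is the length balance of one
step. -/
theorem sum_interlacing_mem_polyFunOn (S : Finset ℤ) {i h h' : ℕ}
    (hh : h + negCount S (i + 1) + posCount S (i + 1) =
      h' + 1 + negCount S i + posCount S i) {f : ℕ × List ℤ → ℚ} (hf : f ∈ polyFun h') :
    (fun x => ∑ t ∈ interlacing (augment S x.1 (i + 1) x.2), f (x.1, t)) ∈
      polyFunOn (admissiblePairs i h) h := by
  set D := admissiblePairs i h with hDdef
  replace hf := polyFun_le_span h' hf
  induction hf using Submodule.span_induction with
  | zero =>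
    simp only [Pi.zero_apply, Finset.sum_const_zero]
    exact Subalgebra.zero_mem _
  | add f g _ _ hf hg =>
    simp only [Pi.add_apply, Finset.sum_add_distrib]
    exact Subalgebra.add_mem _ hf hg
  | smul c f _ hf =>
    simp only [Pi.smul_apply, ← Finset.smul_sum]
    exact Subalgebra.smul_mem _ hf c
  | mem f hf =>
    obtain ⟨a, e, rfl⟩ := hf
    simp only [← Finset.mul_sum]
    have hl : (fun x : ℕ × List ℤ => (x.1 : ℚ)) ∈ polyFunOn D h :=
      polyFun_le_polyFunOn D h (Algebra.subset_adjoin (Or.inl rfl))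
    refine Subalgebra.mul_mem _ (Subalgebra.pow_mem _ hl a) ?_
    -- The augmented list as a list of functions of `(l, t)`. The default of `getD` never occurs on
    -- `D`, where `t` has length `h`.
    set us : List (ℕ × List ℤ → ℤ) :=
      (if -((i + 1 : ℕ) : ℤ) ∈ S then [fun _ => -((i + 1 : ℕ) : ℤ) + 1] else []) ++
        (List.range h).map (fun k x => x.2.getD k 0) ++
        (if ((i + 1 : ℕ) : ℤ) ∈ S then [fun x => (x.1 : ℤ) + (i + 1 : ℕ) - 1] else []) with hus
    have hmap : ∀ x ∈ D, us.map (fun v => v x) = augment S x.1 (i + 1) x.2 := by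
      intro x hx
      rw [hus, augment, List.map_append, List.map_append]
      congr 1
      · congr 1
        · split_ifs <;> simp
        · refine List.ext_getElem (by simpa using hx.2.2.symm) fun k h1 h2 => ?_
          simp [h2]
      · split_ifs <;> simp
    have hlen : us.length = h' + 1 := by
      rw [negCount_succ, posCount_succ] at hh
      rw [hus]
      by_cases h1 : -((i + 1 : ℕ) : ℤ) ∈ S <;> by_cases h2 : ((i + 1 : ℕ) : ℤ) ∈ S <;>
        simp only [h1, h2, if_true, if_false, List.length_append, List.length_nil,
          List.length_cons, List.length_map, List.length_range] at hh ⊢ <;> omega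
    have hmem : ∀ v ∈ us, (fun x => (v x : ℚ)) ∈ polyFunOn D h := by
      intro v hv
      have hc : ∀ c : ℤ, (fun _ : ℕ × List ℤ => (c : ℚ)) ∈ polyFunOn D h := fun c =>
        Subalgebra.algebraMap_mem _ (c : ℚ)
      rw [hus, List.mem_append, List.mem_append] at hv
      rcases hv with (hv | hv) | hv
      · split_ifs at hv
        · rw [List.mem_singleton] at hv
          subst hv
          exact hc _
        · simp at hv
      · obtain ⟨k, hk, rfl⟩ := List.mem_map.1 hv
        exact polyFun_le_polyFunOn D h
          (Algebra.subset_adjoin (Or.inr ⟨k, List.mem_range.1 hk, rfl⟩))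
      · split_ifs at hv
        · rw [List.mem_singleton] at hv
          subst hv
          have := Subalgebra.add_mem _ hl (hc ((i + 1 : ℕ) - 1))
          convert this using 1
          funext x
          simp only [Pi.add_apply]
          push_cast
          ring
        · simp at hv
    have hpw : ∀ x ∈ D, (us.map fun v => v x).Pairwise (· < ·) := fun x hx => by
      rw [hmap x hx]
      exact (isAdmissible_augment hx.1 hx.2.1).1
    have hclosed : ∀ f g : ℕ × List ℤ → ℚ, g ∈ polyFunOn D h → Set.EqOn f g D →
        f ∈ polyFunOn D h := by
      rintro f g ⟨g', hg', hgg'⟩ hfg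
      exact ⟨g', hg', fun x hx => (hfg hx).trans (hgg' hx)⟩
    clear_value us
    cases us with
    | nil => simp at hlen
    | cons u vs =>
      simp only [List.length_cons, Nat.add_right_cancel_iff] at hlen
      have hpw' : ∀ x ∈ D, (∀ w ∈ vs, u x < w x) ∧ (vs.map fun v => v x).Pairwise (· < ·) := by
        intro x hx
        have := hpw x hx
        rw [List.map_cons, List.pairwise_cons] at this
        simpa using this
      have key := sum_fill_listMonomial_mem (polyFunOn D h) D hclosed vs u (hmem u (by simp))
        (fun v hv => hmem v (by simp [hv])) (fun x hx => (hpw' x hx).2)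
        (fun x hx v hv => ((hpw' x hx).1 v hv).le) e
      refine hclosed _ _ key fun x hx => ?_
      rw [← hmap x hx, List.map_cons, interlacing, hlen]

/-- Backward induction: with no step left there is one chain, and each earlier count sums the next
one over interlacing lists. At `i = 0` no list variables remain. -/
theorem card_chainsFrom_mem_polyFunOn {n : ℕ} {S : Finset ℤ}
    (hS : IsCentredCatalanSet (n + 1) S) (m i : ℕ) (hi : i + m = n) :
    (fun x : ℕ × List ℤ => ((chainsFrom S x.1 m i x.2).card : ℚ)) ∈
      polyFunOn (admissiblePairs i (negCount S i + posCount S i - i))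
        (negCount S i + posCount S i - i) := by
  induction m generalizing i with
  | zero =>
    simp only [chainsFrom, Finset.card_singleton, Nat.cast_one]
    exact Subalgebra.one_mem _
  | succ m ih =>
    obtain ⟨g, hg, hfg⟩ := ih (i + 1) (by omega)
    have h1 := hS.le_count (show i ≤ n by omega)
    have h2 := hS.le_count (show i + 1 ≤ n by omega)
    obtain ⟨g', hg', hgg'⟩ := sum_interlacing_mem_polyFunOn S (i := i)
      (h := negCount S i + posCount S i - i)
      (h' := negCount S (i + 1) + posCount S (i + 1) - (i + 1)) (by omega) hg
    refine ⟨g', hg', fun x hx => ?_⟩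
    rw [← hgg' hx]
    dsimp only
    rw [card_chainsFrom_succ hx.1 m i hx.2.1, Nat.cast_sum]
    refine Finset.sum_congr rfl fun t ht => ?_
    have hstep : IsStep S x.1 (i + 1) x.2 t :=
      (mem_interlacing (isAdmissible_augment (S := S) hx.1 hx.2.1).1).1 ht
    refine hfg (x := (x.1, t)) ⟨hx.1, isAdmissible_of_isStep hx.1 hx.2.1 hstep, ?_⟩
    have h3 := hstep.1.1
    have h4 := length_augment S x.1 i x.2
    have h5 := hx.2.2
    dsimp only
    omega

/-- The weight of a centred Catalan set is a polynomial function. -/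
theorem exists_polynomial_weight {n : ℕ} {S : Finset ℤ} (hS : IsCentredCatalanSet (n + 1) S) :
    ∃ P : Polynomial ℚ, ∀ l : ℕ, 1 ≤ l → P.eval (l : ℚ) = (weight l S : ℚ) := by
  obtain ⟨g, hg, hfg⟩ := card_chainsFrom_mem_polyFunOn hS n 0 (by omega)
  rw [negCount_zero, posCount_zero] at hg hfg
  have key : ∃ P : Polynomial ℚ, ∀ x : ℕ × List ℤ, g x = P.eval (x.1 : ℚ) := by
    rw [polyFun] at hg
    clear hfg
    induction hg using Algebra.adjoin_induction with
    | mem f hf =>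
      rcases hf with rfl | ⟨k, hk, -⟩
      · exact ⟨Polynomial.X, fun x => by simp⟩
      · simp at hk
    | algebraMap r => exact ⟨Polynomial.C r, fun x => by simp⟩
    | add f g _ _ hf hg =>
      obtain ⟨P, hP⟩ := hf
      obtain ⟨Q, hQ⟩ := hg
      exact ⟨P + Q, fun x => by simp [hP, hQ]⟩
    | mul f g _ _ hf hg =>
      obtain ⟨P, hP⟩ := hf
      obtain ⟨Q, hQ⟩ := hg
      exact ⟨P * Q, fun x => by simp [hP, hQ]⟩
  obtain ⟨P, hP⟩ := key
  refine ⟨P, fun l hl => ?_⟩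
  have h1 := hfg (x := (l, [])) ⟨hl, isAdmissible_nil l 0, rfl⟩
  rw [weight_eq_ncard_chains hS hl, ncard_chains hl, ← hP (l, []), ← h1]

/-! ### The cells of the skew shape -/

theorem orderEmbOfFin_le_iff (T : Finset ℤ) (j : Fin T.card) (b : ℤ) :
    T.orderEmbOfFin rfl j ≤ b ↔ (j : ℕ) < (T.filter (· ≤ b)).card := by
  set e := T.orderEmbOfFin rfl with he
  constructor
  · intro h
    have h1 : (Finset.Iic j).map e.toEmbedding ⊆ T.filter (· ≤ b) := by
      intro x hx
      obtain ⟨k, hk, rfl⟩ := Finset.mem_map.1 hx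
      exact Finset.mem_filter.2 ⟨T.orderEmbOfFin_mem rfl k,
        (e.monotone (Finset.mem_Iic.1 hk)).trans h⟩
    have := Finset.card_le_card h1
    rw [Finset.card_map, Fin.card_Iic] at this
    omega
  · intro h
    by_contra hb
    have h1 : T.filter (· ≤ b) ⊆ (Finset.Iio j).map e.toEmbedding := by
      intro x hx
      obtain ⟨hx, hxb⟩ := Finset.mem_filter.1 hx
      have : x ∈ Set.range e := by rw [he, Finset.range_orderEmbOfFin]; exact hx
      obtain ⟨k, rfl⟩ := this
      refine Finset.mem_map.2 ⟨k, Finset.mem_Iio.2 ?_, rfl⟩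
      rw [← e.lt_iff_lt]
      omega
    have := Finset.card_le_card h1
    rw [Finset.card_map, Fin.card_Iio] at this
    omega

theorem negCount_add_card (S : Finset ℤ) (i : ℕ) :
    negCount S i + ((negPart S).filter (· ≤ -(i : ℤ) - 1)).card = (negPart S).card := by
  rw [negCount, negPart, Finset.filter_filter, ← Finset.card_union_of_disjoint]
  · congr 1
    ext x
    simp only [Finset.mem_union, Finset.mem_filter]
    by_cases hx : x ∈ S <;> simp only [hx, true_and, false_and, or_false]
    omega
  · rw [Finset.disjoint_filter]
    intro x _
    omega

theorem posCount_eq (S : Finset ℤ) (i : ℕ) :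
    posCount S i = ((posPart S).filter (· ≤ (i : ℤ))).card := by
  rw [posCount, posPart, Finset.filter_filter]

theorem negCount_le_card (S : Finset ℤ) (i : ℕ) : negCount S i ≤ (negPart S).card := by
  have := negCount_add_card S i
  omega

theorem posCount_le_card (S : Finset ℤ) (i : ℕ) : posCount S i ≤ (posPart S).card := by
  rw [posCount_eq]
  exact Finset.card_filter_le _ _

/-- The time at which a cell is created: `c + u - r` for the cell `(r, c)`. -/
def diag (S : Finset ℤ) (x : ℕ × ℕ) : ℕ := x.2 + (negPart S).card - x.1

/-- Row `r` of `μ` reaches column `c` if and only if the negative element with index `r` lies below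
`-(c + u - r)`, that is, if more than `r` negative elements do. -/
theorem mem_mu (S : Finset ℤ) (x : ℕ × ℕ) :
    x ∈ mu S ↔ x.1 + negCount S (diag S x) < (negPart S).card := by
  rw [mu, YoungDiagram.mem_ofRowLens]
  simp only [muParts, List.length_ofFn, List.getElem_ofFn, diag]
  have h := negCount_add_card S (x.2 + (negPart S).card - x.1)
  constructor
  · rintro ⟨h1, h2⟩
    have : x.1 < _ := (orderEmbOfFin_le_iff (negPart S) ⟨x.1, h1⟩
      (-((x.2 + (negPart S).card - x.1 : ℕ) : ℤ) - 1)).1 (by omega)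
    omega
  · intro h1
    have hr : x.1 < (negPart S).card := by omega
    refine ⟨hr, ?_⟩
    have := (orderEmbOfFin_le_iff (negPart S) ⟨x.1, hr⟩
      (-((x.2 + (negPart S).card - x.1 : ℕ) : ℤ) - 1)).2 (show x.1 < _ by omega)
    omega

/-- Column `c` of `λ` reaches row `r` if and only if the positive element with index `c` is at most
`c + u - r`. If that difference is truncated to 0, both sides fail because the elements are
positive. -/
theorem mem_lam (S : Finset ℤ) (x : ℕ × ℕ) : x ∈ lam S ↔ x.2 < posCount S (diag S x) := by
  rw [lam, YoungDiagram.mem_transpose, YoungDiagram.mem_ofRowLens]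
  simp only [lamConjParts, List.length_ofFn, List.getElem_ofFn, diag, Prod.fst_swap,
    Prod.snd_swap]
  have h := posCount_eq S (x.2 + (negPart S).card - x.1)
  constructor
  · rintro ⟨h1, h2⟩
    have hpos := (Finset.mem_filter.1 ((posPart S).orderEmbOfFin_mem rfl ⟨x.2, h1⟩)).2
    have : x.2 < _ := (orderEmbOfFin_le_iff (posPart S) ⟨x.2, h1⟩
      ((x.2 + (negPart S).card - x.1 : ℕ) : ℤ)).1 (by omega)
    omega
  · intro h1
    have h2 := posCount_le_card S (x.2 + (negPart S).card - x.1)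
    have hc : x.2 < (posPart S).card := by omega
    refine ⟨hc, ?_⟩
    have := (orderEmbOfFin_le_iff (posPart S) ⟨x.2, hc⟩
      ((x.2 + (negPart S).card - x.1 : ℕ) : ℤ)).2 (show x.2 < _ by omega)
    have hpos := posCount_le S (x.2 + (negPart S).card - x.1)
    omega

/-- On the diagonal `i` this reads `i - negCount S i ≤ c < posCount S i`, so the number of cells
there is the height of the Motzkin path. -/
theorem mem_skewCells (S : Finset ℤ) (x : ℕ × ℕ) : x ∈ skewCells (lam S) (mu S) ↔
    x.2 < posCount S (diag S x) ∧ (negPart S).card ≤ x.1 + negCount S (diag S x) := by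
  rw [skewCells, Finset.mem_sdiff, YoungDiagram.mem_cells, YoungDiagram.mem_cells, mem_lam,
    mem_mu, not_lt]

/-- The position of a cell among the cells created at the same time. -/
def pos (S : Finset ℤ) (x : ℕ × ℕ) : ℕ := x.1 + negCount S (diag S x) - (negPart S).card

/-- The cell created at time `i` at position `k`. -/
def cellAt (S : Finset ℤ) (i k : ℕ) : ℕ × ℕ :=
  ((negPart S).card + k - negCount S i, i + k - negCount S i)

theorem diag_cellAt (S : Finset ℤ) (i k : ℕ) : diag S (cellAt S i k) = i := by
  have := negCount_le_card S i
  have := negCount_le S i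
  simp only [diag, cellAt]
  omega

theorem pos_cellAt (S : Finset ℤ) (i k : ℕ) : pos S (cellAt S i k) = k := by
  rw [pos, diag_cellAt]
  have := negCount_le_card S i
  have := negCount_le S i
  simp only [cellAt]
  omega

theorem cellAt_mem {S : Finset ℤ} {i k : ℕ} (hk : k < negCount S i + posCount S i - i) :
    cellAt S i k ∈ skewCells (lam S) (mu S) := by
  rw [mem_skewCells, diag_cellAt]
  have := negCount_le_card S i
  have := negCount_le S i
  simp only [cellAt]
  omega

theorem diag_add {S : Finset ℤ} {x : ℕ × ℕ} (hx : x ∈ skewCells (lam S) (mu S)) :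
    diag S x + x.1 = x.2 + (negPart S).card := by
  rw [mem_skewCells] at hx
  have := posCount_le S (diag S x)
  simp only [diag] at *
  omega

theorem pos_add {S : Finset ℤ} {x : ℕ × ℕ} (hx : x ∈ skewCells (lam S) (mu S)) :
    pos S x + (negPart S).card = x.1 + negCount S (diag S x) := by
  rw [mem_skewCells] at hx
  rw [pos]
  omega

theorem pos_lt {S : Finset ℤ} {x : ℕ × ℕ} (hx : x ∈ skewCells (lam S) (mu S)) :
    pos S x < negCount S (diag S x) + posCount S (diag S x) - diag S x := by
  have h1 := diag_add hx
  have h2 := pos_add hx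
  rw [mem_skewCells] at hx
  have := negCount_le S (diag S x)
  omega

theorem cellAt_diag_pos {S : Finset ℤ} {x : ℕ × ℕ} (hx : x ∈ skewCells (lam S) (mu S)) :
    cellAt S (diag S x) (pos S x) = x := by
  have h1 := diag_add hx
  have h2 := pos_add hx
  ext
  · simp only [cellAt]; omega
  · simp only [cellAt]; omega

section Catalan

variable {n : ℕ} {S : Finset ℤ}

theorem diag_lt (hS : IsCentredCatalanSet (n + 1) S) {x : ℕ × ℕ}
    (hx : x ∈ skewCells (lam S) (mu S)) : diag S x < n := by
  by_contra h
  have h1 := pos_lt hx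
  have := hS.count_eq
  have := hS.negCount_of_le le_rfl
  have := hS.posCount_of_le le_rfl
  have := hS.negCount_of_le (not_lt.1 h)
  have := hS.posCount_of_le (not_lt.1 h)
  omega

/-- A cell of `μ` on the diagonal `i` has column below `i - negCount S i`, which non-negative height
bounds by `posCount S i`. For `i ≥ n` all negative elements are counted and `μ` has no cell there.
-/
theorem mu_le_lam (hS : IsCentredCatalanSet (n + 1) S) : mu S ≤ lam S := by
  rw [SetLike.le_def]
  intro x hx
  rw [mem_mu] at hx
  rw [mem_lam]
  have h1 : diag S x + x.1 = x.2 + (negPart S).card := by simp only [diag] at *; omega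
  rcases le_or_gt n (diag S x) with h | h
  · have := hS.negCount_of_le h
    omega
  · have := hS.le_count h.le
    omega

theorem card_skewCells (hS : IsCentredCatalanSet (n + 1) S) :
    (skewCells (lam S) (mu S)).card =
      ∑ i ∈ Finset.range (n + 1), (negCount S i + posCount S i - i) := by
  rw [← Finset.sum_congr rfl fun i _ =>
    Finset.card_range (negCount S i + posCount S i - i), ← Finset.card_sigma]
  refine Finset.card_bij' (fun x _ => ⟨diag S x, pos S x⟩) (fun y _ => cellAt S y.1 y.2) ?_ ?_ ?_ ?_
  · intro x hx
    simp only [Finset.mem_sigma, Finset.mem_range]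
    have := diag_lt hS hx
    exact ⟨by omega, pos_lt hx⟩
  · intro y hy
    simp only [Finset.mem_sigma, Finset.mem_range] at hy
    exact cellAt_mem hy.2
  · intro x hx
    exact cellAt_diag_pos hx
  · rintro ⟨i, k⟩ _
    simp only [diag_cellAt, pos_cellAt]

/-! ### Area of the Motzkin path -/

theorem motzkinStep_succ (S : Finset ℤ) (i : ℕ) : motzkinStep S (i + 1) =
    (negCount S (i + 1) - negCount S i) + (posCount S (i + 1) - posCount S i) - 1 := by
  rw [motzkinStep, negCount_succ, posCount_succ]
  have hne : -((i + 1 : ℕ) : ℤ) ≠ ((i + 1 : ℕ) : ℤ) := by push_cast; omega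
  by_cases h1 : -((i + 1 : ℕ) : ℤ) ∈ S <;> by_cases h2 : ((i + 1 : ℕ) : ℤ) ∈ S
  · rw [Finset.insert_inter_of_mem h1, Finset.singleton_inter_of_mem h2, if_pos h1, if_pos h2,
      Finset.card_pair hne]
    push_cast; ring
  · rw [Finset.insert_inter_of_mem h1, Finset.singleton_inter_of_notMem h2, if_pos h1, if_neg h2]
    simp
  · rw [Finset.insert_inter_of_notMem h1, Finset.singleton_inter_of_mem h2, if_neg h1, if_pos h2]
    simp
  · rw [Finset.insert_inter_of_notMem h1, Finset.singleton_inter_of_notMem h2, if_neg h1,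
      if_neg h2]
    simp

theorem motzkinHeight_eq (S : Finset ℤ) (i : ℕ) :
    motzkinHeight S i = (negCount S i + posCount S i : ℤ) - i := by
  induction i with
  | zero => simp [motzkinHeight, negCount_zero, posCount_zero]
  | succ i ih =>
    have : motzkinHeight S (i + 1) = motzkinHeight S i + motzkinStep S (i + 1) := by
      rw [motzkinHeight, Finset.sum_Icc_succ_top (by omega)]; rfl
    rw [this, ih, motzkinStep_succ]
    push_cast
    ring

/-- The trapezium rule gives the sum of all heights less half the two end heights, which are 0. -/
theorem card_skewCells_eq_area (hS : IsCentredCatalanSet (n + 1) S) :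
    ((skewCells (lam S) (mu S)).card : ℚ) = motzkinArea S := by
  have h1 : ∀ m, ∑ i ∈ Finset.Icc 1 m,
      ((motzkinHeight S (i - 1) : ℚ) + (motzkinHeight S i : ℚ)) / 2 =
      ∑ i ∈ Finset.range (m + 1), (motzkinHeight S i : ℚ) - (motzkinHeight S 0 : ℚ) / 2 -
        (motzkinHeight S m : ℚ) / 2 := by
    intro m
    induction m with
    | zero => simp; ring
    | succ m ih =>
      rw [Finset.sum_Icc_succ_top (by omega), ih, Finset.sum_range_succ _ (m + 1),
        Nat.add_sub_cancel]
      ring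
  have h2 : motzkinHeight S 0 = 0 := by simp [motzkinHeight]
  have h3 : motzkinHeight S n = 0 := by
    rw [motzkinHeight_eq]
    have := hS.count_eq
    omega
  rw [motzkinArea, hS.1, Nat.add_sub_cancel, h1, h2, h3, card_skewCells hS]
  push_cast
  simp only [zero_div, sub_zero]
  refine Finset.sum_congr rfl fun i hi => ?_
  have h4 := hS.le_count (show i ≤ n by have := Finset.mem_range.1 hi; omega)
  rw [motzkinHeight_eq, Nat.cast_sub h4]
  push_cast
  ring

/-! ### Chains and fillings of the skew shape -/

theorem getD_augment {l i k : ℕ} {t : List ℤ} (hk : k < t.length) :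
    (augment S l (i + 1) t).getD (k + negCount S (i + 1) - negCount S i) 0 = t.getD k 0 := by
  rw [negCount_succ, augment]
  split_ifs with h1 h2
  · rw [show k + (negCount S i + 1) - negCount S i = k + 1 by omega]
    simp [List.getElem?_append_left hk]
  · rw [show k + (negCount S i + 1) - negCount S i = k + 1 by omega]
    simp
  · rw [show k + (negCount S i + 0) - negCount S i = k by omega]
    simp [List.getElem?_append_left hk]
  · rw [show k + (negCount S i + 0) - negCount S i = k by omega]
    simp

theorem getD_augment_last {l i : ℕ} {t : List ℤ} (h : posCount S i < posCount S (i + 1)) :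
    (augment S l (i + 1) t).getD (t.length + negCount S (i + 1) - negCount S i) 0 =
      (l : ℤ) + (i + 1 : ℕ) - 1 := by
  rw [posCount_succ] at h
  have h2 : ((i + 1 : ℕ) : ℤ) ∈ S := by
    by_contra hc
    rw [if_neg hc] at h
    omega
  rw [negCount_succ, augment, if_pos h2]
  split_ifs with h1
  · rw [show t.length + (negCount S i + 1) - negCount S i = t.length + 1 by omega]
    simp
  · rw [show t.length + (negCount S i + 0) - negCount S i = t.length by omega]
    simp

theorem getD_augment_zero {l i : ℕ} {t : List ℤ} (h : negCount S i < negCount S (i + 1)) :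
    (augment S l (i + 1) t).getD 0 0 = -((i + 1 : ℕ) : ℤ) + 1 := by
  rw [negCount_succ] at h
  have h2 : -((i + 1 : ℕ) : ℤ) ∈ S := by
    by_contra hc
    rw [if_neg hc] at h
    omega
  rw [augment, if_pos h2]
  simp

/-- The filling of the skew shape associated with a chain. -/
def fillingOf (S : Finset ℤ) (t : ℕ → List ℤ) (x : ℕ × ℕ) : ℤ := (t (diag S x)).getD (pos S x) 0

/-- The right neighbour lies on the next diagonal, so this is a lower interlacing inequality; for
`fillingOf_down` the lower neighbour lies on the previous diagonal and the upper inequality is used.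
-/
theorem fillingOf_right (hS : IsCentredCatalanSet (n + 1) S) {l : ℕ} {t : ℕ → List ℤ}
    (h : IsMonotoneChain S n l t) {r c : ℕ} (h1 : (r, c) ∈ skewCells (lam S) (mu S))
    (h2 : (r, c + 1) ∈ skewCells (lam S) (mu S)) :
    fillingOf S t (r, c) ≤ fillingOf S t (r, c + 1) := by
  have d1 := diag_add h1
  have d2 := diag_add h2
  have p1 := pos_add h1
  have p2 := pos_add h2
  have q1 := pos_lt h1
  have q2 := pos_lt h2
  have l1 := diag_lt hS h1
  have l2 := diag_lt hS h2
  simp only at d1 d2 p1 p2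
  have e : diag S (r, c + 1) = diag S (r, c) + 1 := by omega
  simp only [fillingOf]
  rw [e] at p2 q2 l2 ⊢
  generalize diag S (r, c) = i at *
  have hs := ((h.2.1 i (by omega)).1.2 (pos S (r, c + 1)) (by
    have := h.length (show i + 1 ≤ n by omega); omega)).1
  rw [show pos S (r, c + 1) = pos S (r, c) + negCount S (i + 1) - negCount S i by omega,
    getD_augment (by have := h.length (show i ≤ n by omega); omega)] at hs
  rwa [show pos S (r, c + 1) = pos S (r, c) + negCount S (i + 1) - negCount S i by omega]

theorem fillingOf_down (hS : IsCentredCatalanSet (n + 1) S) {l : ℕ} {t : ℕ → List ℤ}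
    (h : IsMonotoneChain S n l t) {r c : ℕ} (h1 : (r, c) ∈ skewCells (lam S) (mu S))
    (h2 : (r + 1, c) ∈ skewCells (lam S) (mu S)) :
    fillingOf S t (r, c) ≤ fillingOf S t (r + 1, c) := by
  have d1 := diag_add h1
  have d2 := diag_add h2
  have p1 := pos_add h1
  have p2 := pos_add h2
  have q1 := pos_lt h1
  have q2 := pos_lt h2
  have l1 := diag_lt hS h1
  have l2 := diag_lt hS h2
  simp only at d1 d2 p1 p2
  have e : diag S (r, c) = diag S (r + 1, c) + 1 := by omega
  simp only [fillingOf]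
  rw [e] at p1 q1 l1 ⊢
  generalize diag S (r + 1, c) = i at *
  have hs := ((h.2.1 i (by omega)).1.2 (pos S (r, c)) (by
    have := h.length (show i + 1 ≤ n by omega); omega)).2
  rwa [show pos S (r, c) + 1 = pos S (r + 1, c) + negCount S (i + 1) - negCount S i by omega,
    getD_augment (by have := h.length (show i ≤ n by omega); omega)] at hs

theorem fillingOf_bounds (hS : IsCentredCatalanSet (n + 1) S) {l : ℕ} (hl : 1 ≤ l)
    {t : ℕ → List ℤ} (h : IsMonotoneChain S n l t) {x : ℕ × ℕ}
    (hx : x ∈ skewCells (lam S) (mu S)) :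
    -(n : ℤ) ≤ fillingOf S t x ∧ fillingOf S t x ≤ (l : ℤ) + n := by
  have h1 := diag_lt hS hx
  have h2 := pos_lt hx
  have h3 := h.length h1.le
  have hk : pos S x < (t (diag S x)).length := by omega
  have h4 := (h.isAdmissible hl (diag S x)).2 _ (List.getElem_mem hk)
  rw [fillingOf, List.getD_eq_getElem _ _ hk]
  omega

theorem eq_of_fillingOf_eq {l : ℕ} {t t' : ℕ → List ℤ}
    (h : IsMonotoneChain S n l t) (h' : IsMonotoneChain S n l t')
    (heq : ∀ x ∈ skewCells (lam S) (mu S), fillingOf S t x = fillingOf S t' x) : t = t' := by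
  funext i
  rcases le_or_gt i n with hi | hi
  · have h1 := h.length hi
    have h2 := h'.length hi
    refine List.ext_getElem (by omega) fun k hk hk' => ?_
    have := heq _ (cellAt_mem (S := S) (i := i) (k := k) (by omega))
    rwa [fillingOf, fillingOf, diag_cellAt, pos_cellAt, List.getD_eq_getElem _ _ hk,
      List.getD_eq_getElem _ _ hk'] at this
  · rw [h.2.2 i hi, h'.2.2 i hi]

/-- The corner cell lets strict increase along rows and columns pass to diagonals, as is needed for
the lists of a chain to be strict. -/
theorem cell_mem_of_diagonal {κ ν : YoungDiagram} {r c : ℕ} (h1 : (r, c) ∈ skewCells κ ν)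
    (h2 : (r + 1, c + 1) ∈ skewCells κ ν) : (r + 1, c) ∈ skewCells κ ν := by
  simp only [skewCells, Finset.mem_sdiff, YoungDiagram.mem_cells] at *
  exact ⟨κ.up_left_mem le_rfl (Nat.le_succ c) h2.1,
    fun h => h1.2 (ν.up_left_mem (Nat.le_succ r) le_rfl h)⟩

/-- Strictly increasing fillings with entries in `{1, …, l}` come from chains. -/
theorem exists_chain_of_filling (hS : IsCentredCatalanSet (n + 1) S) {l : ℕ}
    (F : ℕ × ℕ → ℤ) (hF : ∀ x ∈ skewCells (lam S) (mu S), 1 ≤ F x ∧ F x ≤ l)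
    (hrow : ∀ r c, (r, c) ∈ skewCells (lam S) (mu S) → (r, c + 1) ∈ skewCells (lam S) (mu S) →
      F (r, c) < F (r, c + 1))
    (hcol : ∀ r c, (r, c) ∈ skewCells (lam S) (mu S) → (r + 1, c) ∈ skewCells (lam S) (mu S) →
      F (r, c) < F (r + 1, c)) :
    ∃ t, IsMonotoneChain S n l t ∧ ∀ x ∈ skewCells (lam S) (mu S), fillingOf S t x = F x := by
  set t : ℕ → List ℤ := fun i =>
    (List.range (negCount S i + posCount S i - i)).map fun k => F (cellAt S i k) with ht
  have hlen : ∀ i, (t i).length = negCount S i + posCount S i - i := fun i => by simp [ht]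
  have hget : ∀ i k, k < negCount S i + posCount S i - i → (t i).getD k 0 = F (cellAt S i k) := by
    intro i k hk
    rw [List.getD_eq_getElem _ _ (by rw [hlen]; exact hk)]
    simp [ht]
  refine ⟨t, ⟨?_, fun i hi => ⟨⟨?_, fun k hk => ?_⟩, ?_⟩, fun i hi => ?_⟩, fun x hx => ?_⟩
  · simp [ht, negCount_zero, posCount_zero]
  · have h1 := length_augment S l i (t i)
    have h2 := hS.le_count hi.le
    have h3 := hS.le_count (show i + 1 ≤ n by omega)
    have := hlen i
    have := hlen (i + 1)
    omega
  · rw [hlen] at hk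
    have h1 := negCount_mono S (Nat.le_succ i)
    have h2 := posCount_mono S (Nat.le_succ i)
    have h1' : negCount S (i + 1) ≤ negCount S i + 1 := by
      rw [negCount_succ]; split_ifs <;> omega
    have h2' : posCount S (i + 1) ≤ posCount S i + 1 := by
      rw [posCount_succ]; split_ifs <;> omega
    have h3 := hS.le_count hi.le
    have h4 := negCount_le S i
    have h5 := negCount_le_card S (i + 1)
    have h6 := negCount_le S (i + 1)
    have hm := cellAt_mem hk
    rw [hget _ _ hk]
    simp only [Nat.succ_eq_add_one] at h1 h2
    constructor
    · rcases le_or_gt (negCount S (i + 1)) (k + negCount S i) with hc | hc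
      · have hk0 : k + negCount S i - negCount S (i + 1) < negCount S i + posCount S i - i := by
          omega
        have hm0 := cellAt_mem hk0
        have := getD_augment (S := S) (l := l) (i := i) (t := t i) (by rw [hlen]; exact hk0)
        rw [show k + negCount S i - negCount S (i + 1) + negCount S (i + 1) - negCount S i = k by
          omega] at this
        rw [this, hget _ _ hk0]
        have e : cellAt S (i + 1) k =
            ((cellAt S i (k + negCount S i - negCount S (i + 1))).1,
              (cellAt S i (k + negCount S i - negCount S (i + 1))).2 + 1) := by
          ext <;> simp only [cellAt] <;> omega
        rw [e] at hm ⊢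
        exact (hrow _ _ hm0 hm).le
      -- No left neighbour: the bound is the added column `-i ≤ 0`, below every entry since entries
      -- are at least 1.
      · rw [show k = 0 by omega, getD_augment_zero (by omega)]
        have := (hF _ hm).1
        rw [show k = 0 by omega] at this
        push_cast
        omega
    · rcases lt_or_ge (k + 1 + negCount S i - negCount S (i + 1))
        (negCount S i + posCount S i - i) with hc | hc
      · have hm0 := cellAt_mem hc
        have := getD_augment (S := S) (l := l) (i := i) (t := t i) (by rw [hlen]; exact hc)
        rw [show k + 1 + negCount S i - negCount S (i + 1) + negCount S (i + 1) - negCount S i =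
          k + 1 by omega] at this
        rw [this, hget _ _ hc]
        have e : cellAt S i (k + 1 + negCount S i - negCount S (i + 1)) =
            ((cellAt S (i + 1) k).1 + 1, (cellAt S (i + 1) k).2) := by
          ext <;> simp only [cellAt] <;> omega
        rw [e] at hm0 ⊢
        exact (hcol _ _ hm hm0).le
      -- No neighbour below: the bound is the added column `l + i`, above every entry since entries
      -- are at most `l`.
      · have := getD_augment_last (S := S) (l := l) (i := i) (t := t i) (by omega)
        rw [hlen, show negCount S i + posCount S i - i + negCount S (i + 1) - negCount S i =
          k + 1 by omega] at this
        rw [this]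
        have := (hF _ hm).2
        push_cast
        omega
  · have step : ∀ k, k + 1 < negCount S (i + 1) + posCount S (i + 1) - (i + 1) →
        F (cellAt S (i + 1) k) < F (cellAt S (i + 1) (k + 1)) := by
      intro k hk
      have hm := cellAt_mem (show k < _ from (Nat.lt_succ_self k).trans hk)
      have hm' := cellAt_mem hk
      have := negCount_le_card S (i + 1)
      have := negCount_le S (i + 1)
      have e : cellAt S (i + 1) (k + 1) =
          ((cellAt S (i + 1) k).1 + 1, (cellAt S (i + 1) k).2 + 1) := by
        ext <;> simp only [cellAt] <;> omega
      rw [e] at hm' ⊢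
      have hm'' := cell_mem_of_diagonal hm hm'
      exact (hcol _ _ hm hm'').trans (hrow _ _ hm'' hm')
    rw [List.pairwise_iff_getElem]
    intro a b ha hb hab
    rw [hlen] at hb
    simp only [ht, List.getElem_map, List.getElem_range]
    induction b, hab using Nat.le_induction with
    | base => exact step a hb
    | succ b hab ih =>
      exact (ih (by rw [hlen]; omega) (by omega)).trans (step b hb)
  · rw [← List.length_eq_zero_iff, hlen, hS.negCount_of_le hi.le, hS.posCount_of_le hi.le]
    have := hS.count_eq
    rw [hS.negCount_of_le le_rfl, hS.posCount_of_le le_rfl] at this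
    omega
  · rw [fillingOf, hget _ _ (pos_lt hx), cellAt_diag_pos hx]

end Catalan

/-! ### Standard Young tableaux and fillings -/

section Standardization

variable {Λ : Finset (ℕ × ℕ)}

/-- The rank of the entry of a cell among all entries of a filling. -/
def entryRank (g : Λ → ℤ) (x : Λ) : ℕ := (Finset.univ.filter fun y => g y ≤ g x).card

theorem entryRank_lt {g : Λ → ℤ} {x y : Λ} (h : g x < g y) : entryRank g x < entryRank g y := by
  refine Finset.card_lt_card (Finset.ssubset_iff_of_subset ?_ |>.2 ⟨y, by simp, by simpa using h⟩)
  intro z hz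
  simp only [Finset.mem_filter, Finset.mem_univ, true_and] at hz ⊢
  exact hz.trans h.le

theorem entryRank_mem (g : Λ → ℤ) (x : Λ) : entryRank g x ∈ Finset.Icc 1 Λ.card := by
  rw [Finset.mem_Icc]
  constructor
  · exact Finset.card_pos.2 ⟨x, by simp⟩
  · exact (Finset.card_filter_le _ _).trans (by simp)

theorem entryRank_injective {g : Λ → ℤ} (hg : Function.Injective g) :
    Function.Injective (entryRank g) := by
  intro x y h
  rcases lt_trichotomy (g x) (g y) with h1 | h1 | h1
  · exact absurd h (entryRank_lt h1).ne
  · exact hg h1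
  · exact absurd h (entryRank_lt h1).ne'

/-- The standardization of a filling with distinct entries. -/
noncomputable def standardization (g : Λ → ℤ) (hg : Function.Injective g) :
    Λ ≃ Finset.Icc 1 Λ.card :=
  Equiv.ofBijective (fun x => ⟨entryRank g x, entryRank_mem g x⟩) <| by
    rw [Fintype.bijective_iff_injective_and_card]
    exact ⟨fun x y h => entryRank_injective hg (congrArg Subtype.val h), by simp⟩

theorem coe_standardization (g : Λ → ℤ) (hg : Function.Injective g) (x : Λ) :
    (standardization g hg x : ℕ) = entryRank g x := rfl

theorem card_image_filter_le {g : Λ → ℤ} (hg : Function.Injective g) (x : Λ) :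
    ((Finset.univ.image g).filter (· ≤ g x)).card = entryRank g x := by
  rw [Finset.filter_image, Finset.card_image_of_injective _ hg]
  rfl

/-- A value is determined by its rank within the set of values. -/
theorem eq_of_standardization_eq {g g' : Λ → ℤ} (hg : Function.Injective g)
    (hg' : Function.Injective g') (h : standardization g hg = standardization g' hg')
    (him : Finset.univ.image g = Finset.univ.image g') : g = g' := by
  funext x
  have h1 := card_image_filter_le hg x
  have h2 := card_image_filter_le hg' x
  have h3 : entryRank g x = entryRank g' x := by
    rw [← coe_standardization g hg, h, coe_standardization]
  have key : ∀ a b : ℤ, ∀ A : Finset ℤ, b ∈ A → (A.filter (· ≤ a)).card =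
      (A.filter (· ≤ b)).card → b ≤ a := by
    intro a b A hb hc
    by_contra hab
    refine absurd hc (Finset.card_lt_card (Finset.ssubset_iff_of_subset ?_ |>.2
      ⟨b, by simp [hb], by simp at hab ⊢; exact fun _ => hab⟩)).ne
    intro z hz
    simp only [Finset.mem_filter] at hz ⊢
    exact ⟨hz.1, by omega⟩
  refine le_antisymm (key _ _ (Finset.univ.image g) (by simp) ?_)
    (key _ _ (Finset.univ.image g) (by rw [him]; simp) ?_)
  · rw [h1, him, h2, h3]
  · rw [h1, him, h2, h3]

end Standardization

/-- The standard Young tableaux of skew shape `κ / ν`. -/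
abbrev SkewSYT (κ ν : YoungDiagram) : Type :=
  {T : ↥(skewCells κ ν) ≃ ↥(Finset.Icc 1 (skewCells κ ν).card) //
    (∀ c d : ↥(skewCells κ ν), c.1.1 = d.1.1 → c.1.2 < d.1.2 → T c < T d) ∧
    (∀ c d : ↥(skewCells κ ν), c.1.2 = d.1.2 → c.1.1 < d.1.1 → T c < T d)}

/-- The filling `g` increases strictly along rows and down columns. -/
def IsStrictFilling {κ ν : YoungDiagram} (g : ↥(skewCells κ ν) → ℤ) : Prop :=
  (∀ c d : ↥(skewCells κ ν), c.1.1 = d.1.1 → c.1.2 < d.1.2 → g c < g d) ∧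
    (∀ c d : ↥(skewCells κ ν), c.1.2 = d.1.2 → c.1.1 < d.1.1 → g c < g d)

/-- The standard Young tableau obtained from a strict filling with distinct entries. -/
noncomputable def IsStrictFilling.toSYT {κ ν : YoungDiagram} {g : ↥(skewCells κ ν) → ℤ}
    (h : IsStrictFilling g) (hg : Function.Injective g) : SkewSYT κ ν :=
  ⟨standardization g hg, fun c d h1 h2 => entryRank_lt (h.1 c d h1 h2),
    fun c d h1 h2 => entryRank_lt (h.2 c d h1 h2)⟩

/-- Standardize the Cantor pairing of the coordinates, which is injective and strictly increasing in
each of them. Positivity is what makes the claimed leading coefficient non-zero. -/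
theorem numSkewSYT_pos (κ ν : YoungDiagram) : 0 < numSkewSYT κ ν := by
  have hs : IsStrictFilling (κ := κ) (ν := ν) fun x => (Nat.pair x.1.1 x.1.2 : ℤ) := by
    constructor
    · intro c d h1 h2
      rw [Nat.cast_lt, h1]
      exact Nat.pair_lt_pair_right _ h2
    · intro c d h1 h2
      rw [Nat.cast_lt, h1]
      exact Nat.pair_lt_pair_left _ h2
  have hi : Function.Injective
      (fun x : ↥(skewCells κ ν) => (Nat.pair x.1.1 x.1.2 : ℤ)) := by
    intro x y h
    have := Nat.pair_eq_pair.1 (Nat.cast_injective h)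
    exact Subtype.ext (Prod.ext this.1 this.2)
  have : Nonempty (SkewSYT κ ν) := ⟨hs.toSYT hi⟩
  exact Nat.card_pos

/-- Send a filling to its standardization and its set of values. -/
theorem card_strict_injective_fillings_le (κ ν : YoungDiagram) (W : Finset ℤ) :
    {g : ↥(skewCells κ ν) → ℤ | (∀ x, g x ∈ W) ∧ Function.Injective g ∧
      IsStrictFilling g}.ncard ≤ numSkewSYT κ ν * W.card.choose (skewCells κ ν).card := by
  rw [numSkewSYT, ← Finset.card_powersetCard, ← Nat.card_eq_finsetCard (W.powersetCard _),
    ← Nat.card_prod, ← Nat.card_coe_set_eq]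
  refine Nat.card_le_card_of_injective
    (fun g => (g.2.2.2.toSYT g.2.2.1, ⟨Finset.univ.image g.1, ?_⟩)) ?_
  · rw [Finset.mem_powersetCard]
    refine ⟨fun y hy => ?_, ?_⟩
    · obtain ⟨x, -, rfl⟩ := Finset.mem_image.1 hy
      exact g.2.1 x
    · rw [Finset.card_image_of_injective _ g.2.2.1]
      simp
  · intro g g' h
    simp only [Prod.mk.injEq, Subtype.mk.injEq] at h
    exact Subtype.ext (eq_of_standardization_eq g.2.2.1 g'.2.2.1
      (congrArg Subtype.val h.1) h.2)

theorem card_not_injective {α : Type*} [Fintype α] (W : Finset ℤ) :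
    {g : α → W | ¬ Function.Injective g}.ncard =
      W.card ^ Fintype.card α - W.card.descFactorial (Fintype.card α) := by
  classical
  have h1 : {g : α → W | Function.Injective g}.ncard = W.card.descFactorial (Fintype.card α) := by
    rw [← Nat.card_coe_set_eq]
    have e : {g : α → W | Function.Injective g} ≃ (α ↪ W) := Equiv.subtypeInjectiveEquivEmbedding α W
    rw [Nat.card_congr e, Nat.card_eq_fintype_card, Fintype.card_embedding_eq, Fintype.card_coe]
  have h2 := Set.ncard_add_ncard_compl {g : α → W | Function.Injective g}
  rw [h1, Nat.card_fun, Nat.card_eq_fintype_card, Nat.card_eq_fintype_card, Fintype.card_coe] at h2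
  rw [← h2, Nat.add_sub_cancel_left]
  rfl

/-! ### Upper and lower bounds for the weight -/

section Catalan

variable {n : ℕ} {S : Finset ℤ}

theorem fillingOf_row (hS : IsCentredCatalanSet (n + 1) S) {l : ℕ} {t : ℕ → List ℤ}
    (h : IsMonotoneChain S n l t) {r c c' : ℕ} (hc : c ≤ c')
    (h1 : (r, c) ∈ skewCells (lam S) (mu S)) (h2 : (r, c') ∈ skewCells (lam S) (mu S)) :
    fillingOf S t (r, c) ≤ fillingOf S t (r, c') := by
  induction c', hc using Nat.le_induction with
  | base => exact le_rfl
  | succ c' hc ih =>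
    have h3 : (r, c') ∈ skewCells (lam S) (mu S) := by
      simp only [skewCells, Finset.mem_sdiff, YoungDiagram.mem_cells] at *
      exact ⟨(lam S).up_left_mem le_rfl (Nat.le_succ c') h2.1,
        fun h => h1.2 ((mu S).up_left_mem le_rfl hc h)⟩
    exact (ih h3).trans (fillingOf_right hS h h3 h2)

theorem fillingOf_col (hS : IsCentredCatalanSet (n + 1) S) {l : ℕ} {t : ℕ → List ℤ}
    (h : IsMonotoneChain S n l t) {r r' c : ℕ} (hr : r ≤ r')
    (h1 : (r, c) ∈ skewCells (lam S) (mu S)) (h2 : (r', c) ∈ skewCells (lam S) (mu S)) :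
    fillingOf S t (r, c) ≤ fillingOf S t (r', c) := by
  induction r', hr using Nat.le_induction with
  | base => exact le_rfl
  | succ r' hr ih =>
    have h3 : (r', c) ∈ skewCells (lam S) (mu S) := by
      simp only [skewCells, Finset.mem_sdiff, YoungDiagram.mem_cells] at *
      exact ⟨(lam S).up_left_mem (Nat.le_succ r') le_rfl h2.1,
        fun h => h1.2 ((mu S).up_left_mem hr le_rfl h)⟩
    exact (ih h3).trans (fillingOf_down hS h h3 h2)

/-- An upper bound for the weight. -/
theorem weight_le (hS : IsCentredCatalanSet (n + 1) S) {l : ℕ} (hl : 1 ≤ l) :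
    weight l S ≤ numSkewSYT (lam S) (mu S) *
        (l + 2 * n + 1).choose (skewCells (lam S) (mu S)).card +
      ((l + 2 * n + 1) ^ (skewCells (lam S) (mu S)).card -
        (l + 2 * n + 1).descFactorial (skewCells (lam S) (mu S)).card) := by
  classical
  set Λ := skewCells (lam S) (mu S) with hΛ
  set W : Finset ℤ := Finset.Icc (-(n : ℤ)) ((l : ℤ) + n) with hW
  have hWc : W.card = l + 2 * n + 1 := by
    rw [hW, Int.card_Icc]; omega
  have hA := card_strict_injective_fillings_le (lam S) (mu S) W
  have hB := card_not_injective (α := Λ) W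
  rw [hWc] at hA hB
  rw [Fintype.card_coe] at hB
  rw [weight_eq_ncard_chains hS hl, ← hB]
  refine le_trans ?_ (Nat.add_le_add_right hA _)
  set X := {g : Λ → ℤ | (∀ x, g x ∈ W) ∧ Function.Injective g ∧ IsStrictFilling g} with hX
  set Y := {g : Λ → W | ¬ Function.Injective g} with hY
  have hXfin : X.Finite := by
    refine (Set.Finite.pi fun _ : Λ => W.finite_toSet).subset ?_
    intro g hg
    simpa using hg.1
  set Y' : Set (Λ → ℤ) := (fun (g : Λ → W) x => (g x : ℤ)) '' Y with hY'
  have hY'fin : Y'.Finite := (Set.toFinite Y).image _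
  have hle : {t | IsMonotoneChain S n l t}.ncard ≤ (X ∪ Y').ncard := by
    refine Set.ncard_le_ncard_of_injOn (fun t (x : Λ) => fillingOf S t x.1) (fun t ht => ?_)
      (fun t ht t' ht' h => eq_of_fillingOf_eq ht ht' fun x hx => congrFun h ⟨x, hx⟩)
      (hXfin.union hY'fin)
    have hb : ∀ x : Λ, fillingOf S t x.1 ∈ W := fun x =>
      Finset.mem_Icc.2 (fillingOf_bounds hS hl ht x.2)
    -- With distinct entries weak increase is automatically strict; all remaining chains are
    -- absorbed into the crude count of non-injective fillings.
    by_cases hi : Function.Injective fun x : Λ => fillingOf S t x.1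
    · refine Or.inl ⟨hb, hi, fun c d h1 h2 => ?_, fun c d h1 h2 => ?_⟩
      · refine lt_of_le_of_ne ?_ fun h => ?_
        · obtain ⟨⟨r, c⟩, hc⟩ := c
          obtain ⟨⟨r', c'⟩, hd⟩ := d
          simp only at h1 h2 ⊢
          subst h1
          exact fillingOf_row hS ht h2.le hc hd
        · rw [hi h] at h2
          exact lt_irrefl _ h2
      · refine lt_of_le_of_ne ?_ fun h => ?_
        · obtain ⟨⟨r, c⟩, hc⟩ := c
          obtain ⟨⟨r', c'⟩, hd⟩ := d
          simp only at h1 h2 ⊢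
          subst h1
          exact fillingOf_col hS ht h2.le hc hd
        · rw [hi h] at h2
          exact lt_irrefl _ h2
    · refine Or.inr ⟨fun x => ⟨fillingOf S t x.1, hb x⟩, fun h => hi ?_, rfl⟩
      intro x y hxy
      exact h (Subtype.ext hxy)
  refine hle.trans ((Set.ncard_union_le X Y').trans ?_)
  exact Nat.add_le_add_left (Set.ncard_image_le (Set.toFinite Y)) _

/-- A lower bound for the weight. -/
theorem le_weight (hS : IsCentredCatalanSet (n + 1) S) {l : ℕ} (hl : 1 ≤ l) :
    numSkewSYT (lam S) (mu S) * l.choose (skewCells (lam S) (mu S)).card ≤ weight l S := by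
  classical
  set Λ := skewCells (lam S) (mu S) with hΛ
  set W : Finset ℤ := Finset.Icc 1 (l : ℤ) with hW
  have hWc : W.card = l := by simp [hW]
  -- Replace the entry `k` of the tableau by the `k`-th smallest element of the chosen subset of
  -- `{1, …, l}`; tableau entries start at 1 and `Fin` indices at 0.
  let F : SkewSYT (lam S) (mu S) × ↥(W.powersetCard Λ.card) → ℕ × ℕ → ℤ := fun y x =>
    if hx : x ∈ Λ then y.2.1.orderEmbOfFin (Finset.mem_powersetCard.1 y.2.2).2
      ⟨(y.1.1 ⟨x, hx⟩ : ℕ) - 1, by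
        have := Finset.mem_Icc.1 (y.1.1 ⟨x, hx⟩).2
        change _ - 1 < Λ.card
        have h2 : ((y.1.1 ⟨x, hx⟩ : ℕ)) ≤ Λ.card := this.2
        omega⟩ else 0
  have hFlt : ∀ y (x x' : Λ), y.1.1 x < y.1.1 x' → F y x.1 < F y x'.1 := by
    intro y x x' h
    simp only [F, dif_pos x.2, dif_pos x'.2]
    refine (Finset.orderEmbOfFin _ _).strictMono ?_
    rw [Fin.mk_lt_mk]
    have h1 := Finset.mem_Icc.1 (y.1.1 x).2
    have h2 : ((y.1.1 x : ℕ)) < (y.1.1 x' : ℕ) := h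
    simp only [Subtype.coe_eta]
    omega
  have hFmem : ∀ y, ∀ x ∈ Λ, F y x ∈ y.2.1 := by
    intro y x hx
    simp only [F, dif_pos hx]
    exact Finset.orderEmbOfFin_mem _ _ _
  have hFinj : ∀ y, Function.Injective fun x : Λ => F y x.1 := by
    intro y x x' h
    rcases lt_trichotomy (y.1.1 x) (y.1.1 x') with h1 | h1 | h1
    · exact absurd h (hFlt y x x' h1).ne
    · exact y.1.1.injective h1
    · exact absurd h (hFlt y x' x h1).ne'
  have hex : ∀ y, ∃ t, IsMonotoneChain S n l t ∧ ∀ x ∈ Λ, fillingOf S t x = F y x := by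
    intro y
    refine exists_chain_of_filling hS (F y) (fun x hx => ?_) (fun r c h1 h2 => ?_)
      (fun r c h1 h2 => ?_)
    · exact Finset.mem_Icc.1 ((Finset.mem_powersetCard.1 y.2.2).1 (hFmem y x hx))
    · exact hFlt y ⟨_, h1⟩ ⟨_, h2⟩ (y.1.2.1 ⟨_, h1⟩ ⟨_, h2⟩ rfl (Nat.lt_succ_self c))
    · exact hFlt y ⟨_, h1⟩ ⟨_, h2⟩ (y.1.2.2 ⟨_, h1⟩ ⟨_, h2⟩ rfl (Nat.lt_succ_self r))
  choose t ht htF using hex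
  have himage : ∀ y, Finset.univ.image (fun x : Λ => F y x.1) = y.2.1 := by
    intro y
    refine Finset.eq_of_subset_of_card_le ?_ ?_
    · intro z hz
      obtain ⟨x, -, rfl⟩ := Finset.mem_image.1 hz
      exact hFmem y x.1 x.2
    · rw [Finset.card_image_of_injective _ (hFinj y), (Finset.mem_powersetCard.1 y.2.2).2]
      simp
  have hinj : Function.Injective fun y => (⟨t y, ht y⟩ : {t | IsMonotoneChain S n l t}) := by
    intro y y' h
    have htt : t y = t y' := congrArg Subtype.val h
    have hFF : ∀ x ∈ Λ, F y x = F y' x := fun x hx => by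
      rw [← htF y x hx, ← htF y' x hx, htt]
    have h2 : y.2 = y'.2 := by
      apply Subtype.ext
      rw [← himage y, ← himage y']
      exact Finset.image_congr fun x _ => hFF x.1 x.2
    have h1 : y.1 = y'.1 := by
      apply Subtype.ext
      ext x
      obtain ⟨T, A⟩ := y
      obtain ⟨T', A'⟩ := y'
      simp only at h2
      subst h2
      have h3 := hFF x.1 x.2
      have hx : (x : ℕ × ℕ) ∈ Λ := x.2
      simp only [F, dif_pos hx] at h3
      have h4 := (Finset.orderEmbOfFin _ _).injective h3
      rw [Fin.mk.injEq] at h4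
      have h5 := (Finset.mem_Icc.1 (T.1 x).2).1
      have h6 := (Finset.mem_Icc.1 (T'.1 x).2).1
      simp only [Subtype.coe_eta] at h4
      simp only
      omega
    exact Prod.ext h1 h2
  have hfin := finite_setOf_isMonotoneChain hS hl
  have : Finite {t | IsMonotoneChain S n l t} := hfin
  have key := Nat.card_le_card_of_injective _ hinj
  rw [weight_eq_ncard_chains hS hl, ← Nat.card_coe_set_eq]
  refine le_trans (le_of_eq ?_) key
  rw [Nat.card_prod, Nat.card_eq_finsetCard, Finset.card_powersetCard, hWc, numSkewSYT]

end Catalan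

/-! ### Asymptotics and the leading coefficient -/

open Filter Topology in
theorem tendsto_shift_pow_div_pow (c : ℚ) (d : ℕ) :
    Tendsto (fun l : ℕ => ((l : ℚ) + c) ^ d / (l : ℚ) ^ d) atTop (𝓝 1) := by
  have h1 : Tendsto (fun l : ℕ => (c : ℚ) / (l : ℚ)) atTop (𝓝 0) :=
    tendsto_natCast_atTop_atTop.const_div_atTop c
  have h2 : Tendsto (fun l : ℕ => (1 + c / (l : ℚ)) ^ d) atTop (𝓝 1) := by
    simpa using (h1.const_add 1).pow d
  refine h2.congr' ?_
  filter_upwards [eventually_ge_atTop 1] with l hl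
  have : (l : ℚ) ≠ 0 := by positivity
  rw [← div_pow]
  congr 1
  field_simp

open Filter Topology in
/-- The asymptotic behaviour of the weight. -/
theorem tendsto_weight_div_pow {n : ℕ} {S : Finset ℤ} (hS : IsCentredCatalanSet (n + 1) S) :
    Tendsto (fun l : ℕ => (weight l S : ℚ) / (l : ℚ) ^ (skewCells (lam S) (mu S)).card) atTop
      (𝓝 ((numSkewSYT (lam S) (mu S) : ℚ) /
        (((skewCells (lam S) (mu S)).card.factorial : ℕ) : ℚ))) := by
  set d := (skewCells (lam S) (mu S)).card with hd
  set e := numSkewSYT (lam S) (mu S) with he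
  have hfac : (0 : ℚ) < (d.factorial : ℕ) := by exact_mod_cast d.factorial_pos
  have hN := tendsto_shift_pow_div_pow (2 * n + 1 : ℚ) d
  -- The shifts in `hM` and `hL` come from `(N + 1 - d) ^ d ≤ N.descFactorial d` with `N = l + 2 * n
  -- + 1` and with `N = l`. In the upper bound, `hN` and `hM` have the same limit, so the
  -- non-injective fillings contribute 0.
  have hM := tendsto_shift_pow_div_pow (2 * n + 2 - d : ℚ) d
  have hL := tendsto_shift_pow_div_pow (1 - d : ℚ) d
  have lower : Tendsto (fun l : ℕ => (e : ℚ) / (d.factorial : ℕ) *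
      (((l : ℚ) + (1 - d)) ^ d / (l : ℚ) ^ d)) atTop (𝓝 ((e : ℚ) / (d.factorial : ℕ))) := by
    simpa using hL.const_mul ((e : ℚ) / (d.factorial : ℕ))
  have upper : Tendsto (fun l : ℕ => (e : ℚ) / (d.factorial : ℕ) *
      (((l : ℚ) + (2 * n + 1)) ^ d / (l : ℚ) ^ d) +
      (((l : ℚ) + (2 * n + 1)) ^ d / (l : ℚ) ^ d -
        ((l : ℚ) + (2 * n + 2 - d)) ^ d / (l : ℚ) ^ d)) atTop
      (𝓝 ((e : ℚ) / (d.factorial : ℕ))) := by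
    simpa using (hN.const_mul ((e : ℚ) / (d.factorial : ℕ))).add (hN.sub hM)
  refine tendsto_of_tendsto_of_tendsto_of_le_of_le' lower upper ?_ ?_
  · filter_upwards [eventually_ge_atTop (d + 1)] with l hl
    have hl0 : (0 : ℚ) < (l : ℚ) ^ d := by
      have : (0 : ℚ) < l := by exact_mod_cast (by omega : 0 < l)
      positivity
    have h1 : (e * l.choose d : ℚ) ≤ weight l S := by
      exact_mod_cast le_weight hS (show 1 ≤ l by omega)
    have h2 : (((l : ℚ) + (1 - d)) ^ d : ℚ) ≤ l.descFactorial d := by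
      have := Nat.pow_sub_le_descFactorial l d
      have h3 : ((l + 1 - d : ℕ) : ℚ) = (l : ℚ) + (1 - d) := by
        rw [Nat.cast_sub (by omega)]; push_cast; ring
      rw [← h3]
      exact_mod_cast this
    rw [← mul_div_assoc]
    gcongr
    refine le_trans ?_ h1
    rw [div_mul_eq_mul_div, mul_div_assoc]
    gcongr
    rw [div_le_iff₀ hfac]
    refine h2.trans (le_of_eq ?_)
    rw [Nat.descFactorial_eq_factorial_mul_choose]
    push_cast
    ring
  · filter_upwards [eventually_ge_atTop (d + 1)] with l hl
    have hl0 : (0 : ℚ) < (l : ℚ) ^ d := by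
      have : (0 : ℚ) < l := by exact_mod_cast (by omega : 0 < l)
      positivity
    set N := l + 2 * n + 1 with hNdef
    have hdesc := Nat.descFactorial_le_pow N d
    have h1 : (weight l S : ℚ) ≤ e * N.choose d + ((N : ℚ) ^ d - N.descFactorial d) := by
      have := weight_le hS (show 1 ≤ l by omega)
      rw [← hd, ← he, ← hNdef] at this
      have h2 : (weight l S : ℚ) ≤
          ((e * N.choose d + (N ^ d - N.descFactorial d) : ℕ) : ℚ) := by exact_mod_cast this
      rw [Nat.cast_add, Nat.cast_sub hdesc] at h2
      push_cast at h2
      exact h2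
    have h2 : (((l : ℚ) + (2 * n + 2 - d)) ^ d : ℚ) ≤ N.descFactorial d := by
      have := Nat.pow_sub_le_descFactorial N d
      have h3 : ((N + 1 - d : ℕ) : ℚ) = (l : ℚ) + (2 * n + 2 - d) := by
        rw [Nat.cast_sub (by omega), hNdef]; push_cast; ring
      rw [← h3]
      exact_mod_cast this
    have h3 : (N : ℚ) = (l : ℚ) + (2 * n + 1) := by rw [hNdef]; push_cast; ring
    have h4 : (N.choose d : ℚ) ≤ (N : ℚ) ^ d / (d.factorial : ℕ) := Nat.choose_le_pow_div d N
    rw [← mul_div_assoc, ← sub_div, ← add_div, ← h3]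
    gcongr
    refine h1.trans ?_
    have h5 : (e : ℚ) * N.choose d ≤ (e : ℚ) / (d.factorial : ℕ) * (N : ℚ) ^ d := by
      rw [div_mul_eq_mul_div, mul_div_assoc]
      gcongr
    linarith

open Filter Topology in
/-- A polynomial is determined in degree and leading coefficient by its growth. -/
theorem degree_and_leadingCoeff_of_tendsto {P : Polynomial ℚ} {d : ℕ} {a : ℚ} (ha : a ≠ 0)
    (h : Tendsto (fun l : ℕ => P.eval (l : ℚ) / (l : ℚ) ^ d) atTop (𝓝 a)) :
    P.degree = d ∧ P.leadingCoeff = a := by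
  have hX : (Polynomial.X ^ d : Polynomial ℚ).degree = d := Polynomial.degree_X_pow d
  have hc := tendsto_natCast_atTop_atTop (R := ℚ)
  have hdeg : P.degree = d := by
    -- A smaller degree would give the limit 0, against `ha`; a larger degree would make the
    -- quotient unbounded.
    rcases lt_trichotomy P.degree d with h1 | h1 | h1
    · have h2 := (Polynomial.div_tendsto_atTop_zero_of_degree_lt P (Polynomial.X ^ d)
        (by rw [hX]; exact h1)).comp hc
      refine absurd (tendsto_nhds_unique h (h2.congr fun l => ?_)) ha
      simp
    · exact h1
    · have h2 := (Polynomial.abs_div_tendsto_atTop_atTop_of_degree_gt P (Polynomial.X ^ d)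
        (by rw [hX]; exact h1) (by simp)).comp hc
      refine absurd h.abs (not_tendsto_nhds_of_tendsto_atTop (h2.congr fun l => ?_) _)
      simp
  refine ⟨hdeg, ?_⟩
  have h2 := (Polynomial.div_tendsto_atTop_leadingCoeff_div_of_degree_eq P (Polynomial.X ^ d)
    (by rw [hX]; exact hdeg)).comp hc
  rw [Polynomial.leadingCoeff_X_pow, div_one] at h2
  refine (tendsto_nhds_unique h (h2.congr fun l => ?_)).symm
  simp

end CentredCatalan

theorem theorem2 (n : ℕ) (S : Finset ℤ) (hS : CentredCatalan.IsCentredCatalanSet (n + 1) S) :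
    CentredCatalan.mu S ≤ CentredCatalan.lam S ∧
    ((CentredCatalan.skewCells (CentredCatalan.lam S) (CentredCatalan.mu S)).card : ℚ) =
      CentredCatalan.motzkinArea S ∧
    ∃ P : Polynomial ℚ,
      (∀ l : ℕ, 1 ≤ l → P.eval (l : ℚ) = (CentredCatalan.weight l S : ℚ)) ∧
      P.degree =
        ((CentredCatalan.skewCells (CentredCatalan.lam S) (CentredCatalan.mu S)).card :
          WithBot ℕ) ∧
      P.leadingCoeff =
        (CentredCatalan.numSkewSYT (CentredCatalan.lam S) (CentredCatalan.mu S) : ℚ) /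
          (((CentredCatalan.skewCells (CentredCatalan.lam S)
            (CentredCatalan.mu S)).card.factorial : ℕ) : ℚ) := by
  refine ⟨CentredCatalan.mu_le_lam hS, CentredCatalan.card_skewCells_eq_area hS, ?_⟩
  obtain ⟨P, hP⟩ := CentredCatalan.exists_polynomial_weight hS
  refine ⟨P, hP, CentredCatalan.degree_and_leadingCoeff_of_tendsto ?_ ?_⟩
  · have h1 := CentredCatalan.numSkewSYT_pos (CentredCatalan.lam S) (CentredCatalan.mu S)
    have h2 := Nat.factorial_pos
      (CentredCatalan.skewCells (CentredCatalan.lam S) (CentredCatalan.mu S)).card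
    positivity
  · refine (CentredCatalan.tendsto_weight_div_pow hS).congr' ?_
    filter_upwards [Filter.eventually_ge_atTop 1] with l hl
    rw [hP l hl]
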